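/- Let $\hbar>0$, let $\mathcal H_c=L^2(\mathbb R)$ be the Hilbert space of an ideal clock, with Hamiltonian $H_c=-i\hbar\,\partial_\tau$ (on its natural domain $H^1(\mathbb R)$) and generalized clock readings $|\tau\rangle_c$, $\tau\in\mathbb R$, and let $\mathcal H_r$ be a separable complex Hilbert space. For a (possibly unbounded) self-adjoint operator $H_r$ on $\mathcal H_r$ and a unit vector $\psi_0\in\mathcal H_r$, the Page–Wootters (PW) system of $(H_r,\psi_0)$ consists of the space $\mathcal H=\mathcal H_c\otimes\mathcal H_r$ (Hilbert space tensor product), the total Hamiltonian $H$, which is the closure of $H_c\otimes I_r+I_c\otimes H_r$ on the span of $\operatorname{dom}H_c\otimes\operatorname{dom}H_r$, the history $\psi(\tau)=e^{-\frac{i}{\hbar}H_r\tau}\psi_0$, the relative temporal states $|\Psi(\tau)\rangle=|\tau\rangle_c|\psi(\tau)\rangle_r$, $\tau\in\mathbb R$, and the timeless state $|\Psi\rangle\rangle=\int_{\mathbb R}|\tau\rangle_c|\psi(\tau)\rangle_r\,d\tau$. The last two are generalized vectors, i.e. antilinear functionals on the space $\mathcal D\subset\mathcal H\cong L^2(\mathbb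 R;\mathcal H_r)$ of continuous compactly supported functions $F:\mathbb R\to\mathcal H_r$: $\langle F|\Psi(\tau)\rangle=\langle F(\tau),\psi(\tau)\rangle$ and $\langle F|\Psi\rangle\rangle=\int_{\mathbb R}\langle F(\tau),\psi(\tau)\rangle\,d\tau$. Any two bare PW systems that have the same clock and the same $\mathcal H_r$, but possibly different world Hamiltonians, are unitarily equivalent, hence indistinguishable. That is, for all self-adjoint operators $H_r$, $H_r'$ on $\mathcal H_r$ and all unit vectors $\psi_0,\psi_0'\in\mathcal H_r$, with $H,|\Psi(\tau)\rangle,|\Psi\rangle\rangle$ the objects of $(H_r,\psi_0)$ and $H',|\Psi'(\tau)\rangle,|\Psi'\rangle\rangle$ those of $(H_r',\psi_0')$, there is a unitary operator $S:\mathcal H_c\otimes\mathcal H_r\to\mathcal H_c\otimes\mathcal H_r$ such that $$H'=S\,H\,S^{-1}$$ (including equality of domains), $S\mathcal D=\mathcal D$, so that $S$ extends to generalized vectors by $\langle F|Su\rangle=\langle S^{-1}F|u\rangle$, and $$|\Psi'(\tau)\rangle=S|\Psi(\tau)\rangle\ \text{ for all }\tau\in\mathbb R,\qquad |\Psi'\rangle\rangle=S|\Psi\rangle\rangle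 .$$ -/

import Mathlib

open MeasureTheory
open scoped TensorProduct ContDiff ComplexConjugate

namespace PageWootters

noncomputable section

/-! ### Unitary dynamics generated by a (possibly unbounded) Hamiltonian -/

section Dynamics

variable {E : Type*} [NormedAddCommGroup E] [InnerProductSpace ℂ E]

/-- `U` is the strongly continuous one-parameter unitary group `t ↦ exp(-(i/ℏ) t A)`: its
infinitesimal generator, with its full domain, is `-(i/ℏ) A`. -/
structure IsUnitaryGroupOf (hbar : ℝ) (A : E →ₗ.[ℂ] E) (U : ℝ → (E ≃ₗᵢ[ℂ] E)) : Prop where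
  map_add : ∀ s t x, U (s + t) x = U s (U t x)
  continuous : ∀ x, Continuous fun t => U t x
  generator : ∀ x y, (x, y) ∈ A.graph ↔
    HasDerivAt (fun t => U t x) ((-(Complex.I / (hbar : ℂ))) • y) 0

open Classical in
/-- The evolution operators `exp(-(i/ℏ) t A)`. For self-adjoint `A` on a Hilbert space the unitary
group generated by `A` exists and is unique by Stone's theorem, so that the default value is used
only for operators `A` that generate no unitary group at all. -/
def evolution (hbar : ℝ) (A : E →ₗ.[ℂ] E) : ℝ → (E ≃ₗᵢ[ℂ] E) :=
  if h : ∃ U, IsUnitaryGroupOf hbar A U then h.choose else fun _ => LinearIsometryEquiv.refl ℂ E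

theorem continuous_evolution (hbar : ℝ) (A : E →ₗ.[ℂ] E) (x : E) :
    Continuous fun t => evolution hbar A t x := by
  unfold evolution
  split_ifs with h
  · exact h.choose_spec.continuous x
  · exact continuous_const

/-- The history `τ ↦ ψ(τ) = exp(-(i/ℏ) τ A) ψ(0)` with initial state `ψ(0) = x`. -/
def history (hbar : ℝ) (A : E →ₗ.[ℂ] E) (x : E) : C(ℝ, E) :=
  ⟨fun τ => evolution hbar A τ x, continuous_evolution hbar A x⟩

/-- The conjugate `S A S⁻¹` of an unbounded operator by a unitary operator, with domain
`S (dom A)`. -/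
def unitaryConj {F : Type*} [NormedAddCommGroup F] [InnerProductSpace ℂ F]
    (S : E ≃ₗᵢ[ℂ] F) (A : E →ₗ.[ℂ] E) : F →ₗ.[ℂ] F where
  domain := A.domain.comap (S.symm.toLinearEquiv : F →ₗ[ℂ] E)
  toFun := (S.toLinearEquiv : E →ₗ[ℂ] F) ∘ₗ A.toFun ∘ₗ
    (S.symm.toLinearEquiv : F →ₗ[ℂ] E).restrict (fun _ hx => hx)

end Dynamics

/-! ### Hilbert tensor product and noninteracting Hamiltonians -/

section Tensor

variable {E F : Type*} [NormedAddCommGroup E] [InnerProductSpace ℂ E]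
  [NormedAddCommGroup F] [InnerProductSpace ℂ F]

variable (E F) in
/-- The Hilbert space tensor product: the completion of the algebraic tensor product for the inner
product `⟪x ⊗ y, x' ⊗ y'⟫ = ⟪x, x'⟫ ⟪y, y'⟫`. -/
abbrev HilbertTensor : Type _ := UniformSpace.Completion (E ⊗[ℂ] F)

/-- The product vector `x ⊗ y` in the Hilbert space tensor product. -/
def prodVec (x : E) (y : F) : HilbertTensor E F := ((x ⊗ₜ[ℂ] y : E ⊗[ℂ] F) : HilbertTensor E F)

/-- The operator `A ⊗ I + I ⊗ B`: the closure of the operator which is defined on the span of the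
`x ⊗ y`, `x ∈ dom A`, `y ∈ dom B`, by `x ⊗ y ↦ A x ⊗ y + x ⊗ B y`. -/
def noninteractingSum (A : E →ₗ.[ℂ] E) (B : F →ₗ.[ℂ] F) :
    HilbertTensor E F →ₗ.[ℂ] HilbertTensor E F :=
  (Submodule.span ℂ {p : HilbertTensor E F × HilbertTensor E F |
    ∃ (x : A.domain) (y : B.domain),
      p = (prodVec (x : E) (y : F), prodVec (A x) (y : F) + prodVec (x : E) (B y))}
    ).topologicalClosure.toLinearPMap

end Tensor

/-! ### The ideal clock -/

/-- The Hilbert space `L²(ℝ)` of the ideal clock. -/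
abbrev ClockSpace : Type := Lp ℂ 2 (volume : Measure ℝ)

theorem integrable_test_smul (f : ClockSpace) {φ : ℝ → ℝ} (hφ : Continuous φ)
    (hc : HasCompactSupport φ) : Integrable (fun τ => φ τ • f τ) (volume : Measure ℝ) :=
  ((Lp.memLp f).locallyIntegrable (by norm_num)).integrable_smul_left_of_hasCompactSupport hφ hc

/-- The graph of `-iℏ ∂/∂τ` in the weak sense: the pairs `(f, h)` in `L²(ℝ)` with
`h = -iℏ f'` as distributions. -/
def clockGraph (hbar : ℝ) : Submodule ℂ (ClockSpace × ClockSpace) where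
  carrier := {p | ∀ φ : ℝ → ℝ, ContDiff ℝ ∞ φ → HasCompactSupport φ →
    ∫ τ, φ τ • p.2 τ = Complex.I * (hbar : ℂ) * ∫ τ, deriv φ τ • p.1 τ}
  zero_mem' := by
    intro φ hφ hc
    have h0 : ((0 : ClockSpace) : ℝ → ℂ) =ᵐ[volume] 0 := Lp.coeFn_zero _ _ _
    have h1 : ∀ g : ℝ → ℝ, ∫ τ, g τ • ((0 : ClockSpace) : ℝ → ℂ) τ = 0 := by
      intro g
      refine integral_eq_zero_of_ae ?_
      filter_upwards [h0] with τ hτ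
      simp only [hτ, Pi.zero_apply, smul_zero]
    simp only [Prod.fst_zero, Prod.snd_zero, h1, mul_zero]
  add_mem' := by
    intro p q hp hq φ hφ hc
    have hadd : ∀ (g : ℝ → ℝ) (u v : ClockSpace), Continuous g → HasCompactSupport g →
        ∫ τ, g τ • (u + v : ClockSpace) τ = (∫ τ, g τ • u τ) + ∫ τ, g τ • v τ := by
      intro g u v hg hgc
      rw [← integral_add (integrable_test_smul u hg hgc) (integrable_test_smul v hg hgc)]
      refine integral_congr_ae ?_
      filter_upwards [Lp.coeFn_add u v] with τ hτ
      simp only [hτ, Pi.add_apply, smul_add]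
    have hd : Continuous (deriv φ) := hφ.continuous_deriv (by simp)
    rw [Prod.snd_add, Prod.fst_add, hadd φ _ _ hφ.continuous hc, hadd _ _ _ hd hc.deriv,
      hp φ hφ hc, hq φ hφ hc, mul_add]
  smul_mem' := by
    intro c p hp φ hφ hc
    have hsmul : ∀ (g : ℝ → ℝ) (u : ClockSpace),
        ∫ τ, g τ • (c • u : ClockSpace) τ = c * ∫ τ, g τ • u τ := by
      intro g u
      rw [← integral_const_mul]
      refine integral_congr_ae ?_
      filter_upwards [Lp.coeFn_smul c u] with τ hτ
      simp only [hτ, Pi.smul_apply, smul_eq_mul, Complex.real_smul]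
      ring
    rw [Prod.smul_snd, Prod.smul_fst, hsmul, hsmul, hp φ hφ hc]
    ring

/-- The graph of `-iℏ ∂/∂τ` is single-valued. -/
theorem clockGraph_snd_eq_zero (hbar : ℝ) (p : ClockSpace × ClockSpace)
    (hp : p ∈ clockGraph hbar) (h0 : p.1 = 0) : p.2 = 0 := by
  rw [Lp.eq_zero_iff_ae_eq_zero]
  refine ae_eq_zero_of_integral_contDiff_smul_eq_zero
    ((Lp.memLp p.2).locallyIntegrable (by norm_num)) ?_
  intro φ hφ hc
  rw [hp φ hφ hc, h0]
  have h1 : ∫ τ, deriv φ τ • ((0 : ClockSpace) : ℝ → ℂ) τ = 0 := by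
    refine integral_eq_zero_of_ae ?_
    filter_upwards [Lp.coeFn_zero ℂ 2 (volume : Measure ℝ)] with τ hτ
    simp only [hτ, Pi.zero_apply, smul_zero]
  rw [h1, mul_zero]

/-- The Hamiltonian `-iℏ ∂/∂τ` of the ideal clock, with domain the Sobolev space `H¹(ℝ)`. -/
def clockHamiltonian (hbar : ℝ) : ClockSpace →ₗ.[ℂ] ClockSpace := (clockGraph hbar).toLinearPMap

/-! ### The Page-Wootters system -/

section System

variable {E : Type*} [NormedAddCommGroup E] [InnerProductSpace ℂ E]

variable (E) in
/-- The Hilbert space `L²(ℝ) ⊗ E` of the clock and the rest of the world. -/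
abbrev TotalSpace : Type _ := HilbertTensor ClockSpace E

/-- The total Hamiltonian `H_c ⊗ I + I ⊗ H_r`. -/
def totalHamiltonian (hbar : ℝ) (Hr : E →ₗ.[ℂ] E) : TotalSpace E →ₗ.[ℂ] TotalSpace E :=
  noninteractingSum (clockHamiltonian hbar) Hr

/-- `Φ ∈ L²(ℝ) ⊗ E` is the vector with the wave function `F : ℝ → E` in the clock variable, that is
`Φ = ∫ |τ⟩ F(τ) dτ`. -/
def HasWaveFunction (Φ : TotalSpace E) (F : ℝ → E) : Prop :=
  ∀ (f : ClockSpace) (x : E), inner ℂ (prodVec f x) Φ = ∫ τ, inner ℂ (f τ • x) (F τ)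

theorem integrable_inner_of_continuous (f : ClockSpace) (x : E) {F : ℝ → E} (hF : Continuous F)
    (hc : HasCompactSupport F) :
    Integrable (fun τ => inner ℂ (f τ • x) (F τ)) (volume : Measure ℝ) := by
  have hg : Continuous fun τ => inner ℂ (F τ) x := hF.inner continuous_const
  have hgc : HasCompactSupport fun τ => inner ℂ (F τ) x :=
    hc.comp_left (g := fun v : E => inner ℂ v x) (inner_zero_left x)
  have h0 : Integrable (fun τ => inner ℂ (F τ) x • f τ) (volume : Measure ℝ) :=
    ((Lp.memLp f).locallyIntegrable
      (by norm_num)).integrable_smul_left_of_hasCompactSupport hg hgc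
  have h := (LinearIsometryEquiv.integrable_comp_iff
    (Complex.conjLIE : ℂ ≃ₗᵢ[ℝ] ℂ)).mpr h0
  refine h.congr (Filter.Eventually.of_forall fun τ => ?_)
  simp

theorem HasWaveFunction.add {Φ Ψ : TotalSpace E} {F G : ℝ → E} (hΦ : HasWaveFunction Φ F)
    (hΨ : HasWaveFunction Ψ G) (hF : Continuous F) (hFc : HasCompactSupport F)
    (hG : Continuous G) (hGc : HasCompactSupport G) : HasWaveFunction (Φ + Ψ) (F + G) := by
  intro f x
  simp only [inner_add_right, hΦ f x, hΨ f x, Pi.add_apply]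
  rw [integral_add (integrable_inner_of_continuous f x hF hFc)
    (integrable_inner_of_continuous f x hG hGc)]

theorem HasWaveFunction.smul {Φ : TotalSpace E} {F : ℝ → E} (hΦ : HasWaveFunction Φ F) (c : ℂ) :
    HasWaveFunction (c • Φ) (c • F) := by
  intro f x
  simp only [inner_smul_right, hΦ f x, Pi.smul_apply]
  rw [integral_const_mul]

theorem hasWaveFunction_zero : HasWaveFunction (0 : TotalSpace E) 0 := by
  intro f x
  simp

/-- A continuous compactly supported wave function is determined by its vector. -/
theorem HasWaveFunction.unique {Φ : TotalSpace E} {F G : ℝ → E} (hΦF : HasWaveFunction Φ F)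
    (hΦG : HasWaveFunction Φ G) (hF : Continuous F) (hFc : HasCompactSupport F)
    (hG : Continuous G) (hGc : HasCompactSupport G) : F = G := by
  funext τ₀
  by_contra hne
  set x : E := F τ₀ - G τ₀ with hx
  have hx0 : x ≠ 0 := sub_ne_zero.mpr hne
  set u : ℝ → ℂ := fun τ => inner ℂ x (F τ - G τ) with hu
  have huc : Continuous u := continuous_const.inner (hF.sub hG)
  have hus : HasCompactSupport u :=
    (hFc.sub hGc).comp_left (g := fun v : E => inner ℂ x v) (inner_zero_right x)
  have hmem : MemLp u 2 (volume : Measure ℝ) := huc.memLp_of_hasCompactSupport hus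
  have h := (hΦF (hmem.toLp u) x).symm.trans (hΦG (hmem.toLp u) x)
  rw [← sub_eq_zero, ← integral_sub (integrable_inner_of_continuous _ x hF hFc)
    (integrable_inner_of_continuous _ x hG hGc)] at h
  have h2 : ∫ τ, ((‖u τ‖ ^ 2 : ℝ) : ℂ) = 0 := by
    rw [← h]
    refine integral_congr_ae ?_
    filter_upwards [hmem.coeFn_toLp] with τ hτ
    rw [hτ, ← inner_sub_right, inner_smul_left, Complex.ofReal_pow, ← Complex.conj_mul']
  rw [integral_complex_ofReal] at h2
  have h3 : 0 < ∫ τ, ‖u τ‖ ^ 2 := by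
    refine Continuous.integral_pos_of_hasCompactSupport_nonneg_nonzero (x := τ₀)
      (huc.norm.pow 2) ?_ (fun τ => sq_nonneg _) ?_
    · exact hus.comp_left (g := fun z : ℂ => ‖z‖ ^ 2) (by simp)
    · have : u τ₀ ≠ 0 := by
        simp only [hu, ← hx]
        exact inner_self_ne_zero.mpr hx0
      positivity
  exact h3.ne' (by exact_mod_cast h2)

variable (E) in
/-- The test space of the rigged Hilbert space: the vectors `∫ |τ⟩ F(τ) dτ` for continuous
compactly supported `F : ℝ → E`. -/
def testSpace : Submodule ℂ (TotalSpace E) where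
  carrier := {Φ | ∃ F : ℝ → E, Continuous F ∧ HasCompactSupport F ∧ HasWaveFunction Φ F}
  zero_mem' := ⟨0, continuous_zero, HasCompactSupport.zero, hasWaveFunction_zero⟩
  add_mem' := by
    rintro Φ Ψ ⟨F, hF, hFc, hΦ⟩ ⟨G, hG, hGc, hΨ⟩
    exact ⟨F + G, hF.add hG, hFc.add hGc, hΦ.add hΨ hF hFc hG hGc⟩
  smul_mem' := by
    rintro c Φ ⟨F, hF, hFc, hΦ⟩
    exact ⟨c • F, hF.const_smul c, hFc.comp_left (g := fun v : E => c • v) (smul_zero c),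
      hΦ.smul c⟩

/-- The continuous compactly supported wave function of a test vector. -/
def waveFunction (Φ : testSpace E) : ℝ → E := Φ.2.choose

theorem waveFunction_continuous (Φ : testSpace E) : Continuous (waveFunction Φ) :=
  Φ.2.choose_spec.1

theorem waveFunction_hasCompactSupport (Φ : testSpace E) : HasCompactSupport (waveFunction Φ) :=
  Φ.2.choose_spec.2.1

theorem hasWaveFunction_waveFunction (Φ : testSpace E) :
    HasWaveFunction (Φ : TotalSpace E) (waveFunction Φ) :=
  Φ.2.choose_spec.2.2

theorem waveFunction_add (Φ Ψ : testSpace E) :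
    waveFunction (Φ + Ψ) = waveFunction Φ + waveFunction Ψ :=
  (hasWaveFunction_waveFunction (Φ + Ψ)).unique
    ((hasWaveFunction_waveFunction Φ).add (hasWaveFunction_waveFunction Ψ)
      (waveFunction_continuous Φ) (waveFunction_hasCompactSupport Φ)
      (waveFunction_continuous Ψ) (waveFunction_hasCompactSupport Ψ))
    (waveFunction_continuous _) (waveFunction_hasCompactSupport _)
    ((waveFunction_continuous Φ).add (waveFunction_continuous Ψ))
    ((waveFunction_hasCompactSupport Φ).add (waveFunction_hasCompactSupport Ψ))

theorem waveFunction_smul (c : ℂ) (Φ : testSpace E) :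
    waveFunction (c • Φ) = c • waveFunction Φ :=
  (hasWaveFunction_waveFunction (c • Φ)).unique ((hasWaveFunction_waveFunction Φ).smul c)
    (waveFunction_continuous _) (waveFunction_hasCompactSupport _)
    ((waveFunction_continuous Φ).const_smul c)
    ((waveFunction_hasCompactSupport Φ).comp_left (g := fun v : E => c • v) (smul_zero c))

variable (E) in
/-- Generalized vectors `|u⟩`: antilinear functionals `Φ ↦ ⟨Φ|u⟩` on the test space. -/
abbrev GeneralizedVector : Type _ := testSpace E →ₗ⋆[ℂ] ℂ

/-- The generalized vector `|τ⟩ ⊗ |x⟩`, where `|τ⟩` is the clock reading `τ`: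
`⟨Φ|τ, x⟩ = ⟪F(τ), x⟫` for the test vector `Φ` with wave function `F`. -/
def ketProd (τ : ℝ) (x : E) : GeneralizedVector E where
  toFun Φ := inner ℂ (waveFunction Φ τ) x
  map_add' Φ Ψ := by rw [waveFunction_add, Pi.add_apply, inner_add_left]
  map_smul' c Φ := by
    rw [waveFunction_smul, Pi.smul_apply, inner_smul_left, smul_eq_mul]

theorem integrable_waveFunction_inner (Φ : testSpace E) (ψ : C(ℝ, E)) :
    Integrable (fun τ => inner ℂ (waveFunction Φ τ) (ψ τ)) (volume : Measure ℝ) := by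
  refine ((waveFunction_continuous Φ).inner ψ.continuous).integrable_of_hasCompactSupport ?_
  refine (waveFunction_hasCompactSupport Φ).mono' ?_
  intro τ hτ
  apply subset_closure
  intro h0
  apply hτ
  simp [h0]

/-- The timeless state `∫ |τ⟩ |ψ(τ)⟩ dτ`, a generalized vector. -/
def timelessState (ψ : C(ℝ, E)) : GeneralizedVector E where
  toFun Φ := ∫ τ, ketProd τ (ψ τ) Φ
  map_add' Φ Ψ := by
    simp only [map_add]
    exact integral_add (integrable_waveFunction_inner Φ ψ) (integrable_waveFunction_inner Ψ ψ)
  map_smul' c Φ := by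
    simp only [LinearMap.map_smulₛₗ, smul_eq_mul]
    exact integral_const_mul _ _

/-- The relative temporal state `|Ψ(τ)⟩ = |τ⟩ |ψ(τ)⟩` of the history of the initial world state
`ψ₀` under the world Hamiltonian `Hr`. -/
def temporalState (hbar : ℝ) (Hr : E →ₗ.[ℂ] E) (ψ₀ : E) (τ : ℝ) : GeneralizedVector E :=
  ketProd τ (history hbar Hr ψ₀ τ)

/-- The extension by duality of a unitary operator `S` to generalized vectors,
`⟨Φ|S u⟩ = ⟨S⁻¹ Φ|u⟩`; it makes sense when `S⁻¹` preserves the test space. -/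
def mapGeneralized {F : Type*} [NormedAddCommGroup F] [InnerProductSpace ℂ F]
    (S : TotalSpace E ≃ₗᵢ[ℂ] TotalSpace F) (hS : ∀ Φ ∈ testSpace F, S.symm Φ ∈ testSpace E)
    (u : GeneralizedVector E) : GeneralizedVector F :=
  u.comp ((S.symm.toLinearEquiv : TotalSpace F →ₗ[ℂ] TotalSpace E).restrict hS)

end System

end

end PageWootters

/-! Let `U` and `U'` be the unitary groups of the two world Hamiltonians. On `L²(ℝ; E)` the total
Hamiltonian generates `F ↦ (τ ↦ U t (F (τ - t)))`: the clock part translates and the world part acts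
on values. Passing to the interaction picture, that is, multiplying by `U (-τ)` at each `τ`, leaves
pure translation and removes the world Hamiltonian altogether, so all these systems are equivalent.
Going back with `U'` gives the operator of multiplication by `V τ = U' τ ∘ W ∘ U (-τ)`, where `W` is
a unitary with `W ψ₀ = ψ₀'`. It satisfies `V τ (U t x) = U' t (V (τ - t) x)`
(`historyTransport_apply_evolution`), which says that it intertwines the two total evolutions, and
it carries one history to the other at every `τ`. Since it acts fibrewise and `V` is strongly
continuous with strongly continuous inverse, it preserves the test space and sends `|τ⟩|x⟩` to
`|τ⟩|V τ x⟩`.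

The analytic work lies in passing from groups to Hamiltonians with their exact domains. Stone's
theorem supplies `U` and `U'` (`exists_isUnitaryGroupOf`); the weak derivative is shown to generate
translations (`isUnitaryGroupOf_clockHamiltonian`); and a core criterion
(`mem_topologicalClosure_iff_of_core`) shows that the closure of `H_c ⊗ I + I ⊗ H_r` is the full
generator of the product group (`isUnitaryGroupOf_noninteractingSum`). Conjugate groups then have
conjugate generators, domains included (`IsUnitaryGroupOf.eq_unitaryConj`). -/

namespace PageWootters

noncomputable section

/-! ### Strongly continuous unitary groups and their generators -/

section UnitaryGroups

variable {E : Type*} [NormedAddCommGroup E] [InnerProductSpace ℂ E]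

/-- A strongly continuous family of isometries is jointly continuous. -/
theorem continuous_uncurry_of_isometry {X : Type*} [TopologicalSpace X] {V : X → (E ≃ₗᵢ[ℂ] E)}
    (hV : ∀ x, Continuous fun t => V t x) : Continuous fun p : X × E => V p.1 p.2 := by
  rw [continuous_iff_continuousAt]
  rintro ⟨t₀, x₀⟩
  rw [ContinuousAt, tendsto_iff_norm_sub_tendsto_zero]
  have h1 : Filter.Tendsto (fun p : X × E => ‖p.2 - x₀‖ + ‖V p.1 x₀ - V t₀ x₀‖)
      (nhds (t₀, x₀)) (nhds 0) := by
    have : Continuous fun p : X × E => ‖p.2 - x₀‖ + ‖V p.1 x₀ - V t₀ x₀‖ :=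
      (continuous_snd.sub continuous_const).norm.add
        (((hV x₀).comp continuous_fst).sub continuous_const).norm
    simpa using this.tendsto (t₀, x₀)
  refine squeeze_zero (fun _ => norm_nonneg _) (fun p => ?_) h1
  calc ‖V p.1 p.2 - V t₀ x₀‖ = ‖V p.1 (p.2 - x₀) + (V p.1 x₀ - V t₀ x₀)‖ := by
        rw [map_sub]; abel_nf
    _ ≤ _ := by
        refine (norm_add_le _ _).trans ?_
        rw [LinearIsometryEquiv.norm_map]

/-- The vectors with continuous orbits under a family of isometries form a closed set. -/
theorem isClosed_setOf_continuous_orbit {X : Type*} [TopologicalSpace X]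
    (V : X → (E ≃ₗᵢ[ℂ] E)) : IsClosed {x | Continuous fun t => V t x} := by
  refine isClosed_of_closure_subset fun x hx => ?_
  refine continuous_of_uniform_approx_of_continuous fun W hW => ?_
  obtain ⟨ε, hε, hεW⟩ := Metric.mem_uniformity_dist.mp hW
  obtain ⟨x', hx', hd⟩ := Metric.mem_closure_iff.mp hx ε hε
  exact ⟨fun t => V t x', hx', fun t => hεW (by rwa [(V t).dist_map])⟩

/-- A strongly continuous one-parameter unitary group. -/
structure IsUnitaryGroup (U : ℝ → (E ≃ₗᵢ[ℂ] E)) : Prop where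
  map_add : ∀ s t x, U (s + t) x = U s (U t x)
  continuous : ∀ x, Continuous fun t => U t x

theorem IsUnitaryGroupOf.isUnitaryGroup {hbar : ℝ} {A : E →ₗ.[ℂ] E} {U : ℝ → (E ≃ₗᵢ[ℂ] E)}
    (h : IsUnitaryGroupOf hbar A U) : IsUnitaryGroup U :=
  ⟨h.map_add, h.continuous⟩

namespace IsUnitaryGroup

variable {U : ℝ → (E ≃ₗᵢ[ℂ] E)}

theorem map_zero (hU : IsUnitaryGroup U) (x : E) : U 0 x = x := by
  apply (U 0).injective
  rw [← hU.map_add, add_zero]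

/-- Since `U s x = U t (U (s - t) x)` and `U t` is bounded linear, differentiability at `0`
propagates to all times. -/
theorem hasDerivAt (hU : IsUnitaryGroup U) {x y : E} (h : HasDerivAt (fun t => U t x) y 0)
    (t : ℝ) : HasDerivAt (fun t => U t x) (U t y) t := by
  have h1 : HasDerivAt (fun s => U t (U s x)) (U t y) (t - t) := by
    rw [sub_self]
    exact ((U t).toContinuousLinearEquiv : E →L[ℂ] E).restrictScalars ℝ
      |>.hasFDerivAt.comp_hasDerivAt (0 : ℝ) h
  have h2 := h1.comp_sub_const t t
  refine h2.congr_of_eventuallyEq (Filter.Eventually.of_forall fun s => ?_)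
  simp only [← hU.map_add]
  congr 2
  ring

theorem sub_eq_integral [CompleteSpace E] (hU : IsUnitaryGroup U) {x y : E}
    (h : HasDerivAt (fun t => U t x) y 0) (t : ℝ) : U t x - x = ∫ s in (0 : ℝ)..t, U s y := by
  rw [intervalIntegral.integral_eq_sub_of_hasDerivAt (fun s _ => hU.hasDerivAt h s)
    ((hU.continuous y).intervalIntegrable _ _), hU.map_zero]

theorem hasDerivAt_integral [CompleteSpace E] (hU : IsUnitaryGroup U) (x : E) (t : ℝ) :
    HasDerivAt (fun t => ∫ s in (0 : ℝ)..t, U s x) (U t x) t :=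
  ((hU.continuous x).integral_hasStrictDerivAt 0 t).hasDerivAt

/-- The integrated equation contains no derivative, so it survives limits in `x` and `y`, limits of
approximating groups, and testing against functions. Generators are handled in this form below. -/
theorem hasDerivAt_zero_iff [CompleteSpace E] (hU : IsUnitaryGroup U) {x y : E} :
    HasDerivAt (fun t => U t x) y 0 ↔ ∀ t, U t x - x = ∫ s in (0 : ℝ)..t, U s y := by
  refine ⟨fun h t => hU.sub_eq_integral h t, fun h => ?_⟩
  have h1 := (hU.hasDerivAt_integral y 0).const_add x
  rw [hU.map_zero] at h1
  refine h1.congr_of_eventuallyEq (Filter.Eventually.of_forall fun t => ?_)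
  simp only [← h t, add_sub_cancel]

theorem continuous_integral (hU : IsUnitaryGroup U) (t : ℝ) :
    Continuous fun x => ∫ s in (0 : ℝ)..t, U s x :=
  intervalIntegral.continuous_parametric_intervalIntegral_of_continuous'
    (f := fun x s => U s x)
    ((continuous_uncurry_of_isometry hU.continuous).comp continuous_swap) 0 t

theorem isClosed_generator [CompleteSpace E] (hU : IsUnitaryGroup U) (c : ℂ) :
    IsClosed {p : E × E | HasDerivAt (fun t => U t p.1) (c • p.2) 0} := by
  simp only [hU.hasDerivAt_zero_iff, Set.ofPred_forall]
  refine isClosed_iInter fun t => isClosed_eq ?_ ?_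
  · exact ((U t).continuous.comp continuous_fst).sub continuous_fst
  · exact (hU.continuous_integral t).comp (continuous_snd.const_smul c)

/-- The averages of an orbit converge to its starting point. -/
theorem tendsto_average [CompleteSpace E] (hU : IsUnitaryGroup U) (x : E) :
    Filter.Tendsto (fun t : ℝ => t⁻¹ • ∫ s in (0 : ℝ)..t, U s x) (nhdsWithin 0 {0}ᶜ)
      (nhds x) := by
  have h := hasDerivAt_iff_tendsto_slope_zero.mp (hU.hasDerivAt_integral x 0)
  simpa [hU.map_zero] using h

/-- Orbit averages lie in the domain of the generator. -/
theorem hasDerivAt_apply_integral [CompleteSpace E] (hU : IsUnitaryGroup U) (x : E) (s : ℝ) :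
    HasDerivAt (fun t => U t (∫ r in (0 : ℝ)..s, U r x)) (U s x - x) 0 := by
  -- Applying `U t` only shifts the interval of integration to `[t, t + s]`; the orbit average is
  -- therefore differentiable even when `x` is not in the domain.
  have h1 : ∀ t, U t (∫ r in (0 : ℝ)..s, U r x) =
      (∫ r in (0 : ℝ)..(t + s), U r x) - ∫ r in (0 : ℝ)..t, U r x := by
    intro t
    have h2 := (((U t).toContinuousLinearEquiv : E →L[ℂ] E).intervalIntegral_comp_comm
      ((hU.continuous x).intervalIntegrable (μ := volume) 0 s)).symm
    have h3 : (∫ r in (0 : ℝ)..s, U t (U r x)) = ∫ r in t..(t + s), U r x := by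
      simp only [← hU.map_add]
      rw [intervalIntegral.integral_comp_add_left (fun r => U r x) t, add_zero]
    rw [intervalIntegral.integral_interval_sub_left
      ((hU.continuous x).intervalIntegrable _ _) ((hU.continuous x).intervalIntegrable _ _), ← h3]
    exact h2
  have h4 : HasDerivAt (fun t => ∫ r in (0 : ℝ)..(t + s), U r x) (U s x) 0 := by
    have := hU.hasDerivAt_integral x (0 + s)
    rw [zero_add] at this
    simpa using HasDerivAt.comp_add_const (0 : ℝ) s (by simpa using this)
  have h5 := h4.sub (hU.hasDerivAt_integral x 0)
  rw [hU.map_zero] at h5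
  exact h5.congr_of_eventuallyEq (Filter.Eventually.of_forall h1)

/-- The domain of the generator is dense. -/
theorem dense_generator [CompleteSpace E] (hU : IsUnitaryGroup U) :
    Dense {x : E | ∃ y, HasDerivAt (fun t => U t x) y 0} := by
  intro x
  refine mem_closure_of_tendsto (hU.tendsto_average x) (Filter.Eventually.of_forall fun t => ?_)
  refine ⟨t⁻¹ • (U t x - x), ?_⟩
  simp only [← Complex.coe_smul, map_smul]
  exact (hU.hasDerivAt_apply_integral x t).const_smul _

/-- A dense invariant subspace of the domain of the generator is a core. -/
theorem mem_topologicalClosure_iff_of_core [CompleteSpace E] (hU : IsUnitaryGroup U) {c : ℂ}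
    (hc : c ≠ 0) {N : Submodule ℂ (E × E)}
    (hN : ∀ p ∈ N, HasDerivAt (fun t => U t p.1) (c • p.2) 0)
    (hinv : ∀ t, ∀ p ∈ N, (U t p.1, U t p.2) ∈ N) (hd : Dense (Prod.fst '' (N : Set (E × E))))
    (p : E × E) :
    p ∈ N.topologicalClosure ↔ HasDerivAt (fun t => U t p.1) (c • p.2) 0 := by
  constructor
  · intro hp
    exact (closure_minimal (t := {p : E × E | HasDerivAt (fun t => U t p.1) (c • p.2) 0}) hN
      (hU.isClosed_generator c)) hp
  intro hp
  set K := N.topologicalClosure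
  have hK : IsClosed (K : Set (E × E)) := N.isClosed_topologicalClosure
  have : CompleteSpace K := hK.completeSpace_coe
  -- The orbit of `p` is integrated inside the complete space `K`, so the integral lies in `K`
  -- automatically; the two components are then read off by the projections.
  have h1 : ∀ t, ∀ p ∈ N, ((∫ r in (0 : ℝ)..t, U r p.1), c⁻¹ • (U t p.1 - p.1)) ∈ K := by
    intro t p hp
    let f : ℝ → K := fun r => ⟨(U r p.1, U r p.2), N.le_topologicalClosure (hinv r p hp)⟩
    have hf : Continuous f :=
      ((hU.continuous p.1).prodMk (hU.continuous p.2)).subtype_mk _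
    have hint := hf.intervalIntegrable (μ := volume) 0 t
    have h2 := (∫ r in (0 : ℝ)..t, f r).2
    have h4 : ((∫ r in (0 : ℝ)..t, f r : K) : E × E) =
        ((∫ r in (0 : ℝ)..t, U r p.1), ∫ r in (0 : ℝ)..t, U r p.2) := by
      refine Prod.ext ?_ ?_
      · exact (((ContinuousLinearMap.fst ℂ E E).comp K.subtypeL).intervalIntegral_comp_comm
          hint).symm
      · exact (((ContinuousLinearMap.snd ℂ E E).comp K.subtypeL).intervalIntegral_comp_comm
          hint).symm
    have h5 : c⁻¹ • (U t p.1 - p.1) = ∫ r in (0 : ℝ)..t, U r p.2 := by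
      rw [hU.sub_eq_integral (hN p hp) t]
      simp only [map_smul]
      rw [intervalIntegral.integral_smul, inv_smul_smul₀ hc]
    rw [h5, ← h4]
    exact h2
  -- Integration has removed `p.2`: the pair depends continuously on `p.1` alone, so density of the
  -- first components reaches every `x`.
  have h2 : ∀ t x, ((∫ r in (0 : ℝ)..t, U r x), c⁻¹ • (U t x - x)) ∈ K := by
    intro t x
    have hcl : IsClosed {x : E | ((∫ r in (0 : ℝ)..t, U r x), c⁻¹ • (U t x - x)) ∈ K} :=
      hK.preimage ((hU.continuous_integral t).prodMk
        (((U t).continuous.sub continuous_id).const_smul c⁻¹))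
    refine (closure_minimal ?_ hcl) (hd x)
    rintro _ ⟨p, hp, rfl⟩
    exact h1 t p hp
  -- Dividing by `t` and letting `t → 0` recovers an arbitrary point of the generator's graph as a
  -- limit of points of `K`.
  have h3 : Filter.Tendsto (fun t : ℝ => (t⁻¹ : ℝ) • ((∫ r in (0 : ℝ)..t, U r p.1),
      c⁻¹ • (U t p.1 - p.1))) (nhdsWithin 0 {0}ᶜ) (nhds p) := by
    have h4 := hasDerivAt_iff_tendsto_slope_zero.mp hp
    have h5 := (hU.tendsto_average p.1).prodMk_nhds (h4.const_smul c⁻¹)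
    rw [inv_smul_smul₀ hc] at h5
    refine h5.congr fun t => ?_
    simp only [zero_add, hU.map_zero, Prod.smul_mk]
    rw [smul_comm]
  refine hK.mem_of_tendsto h3 (Filter.Eventually.of_forall fun t => ?_)
  exact (K.restrictScalars ℝ).smul_mem t⁻¹ (h2 t p.1)

end IsUnitaryGroup

theorem neg_I_div_ne_zero {hbar : ℝ} (h : hbar ≠ 0) : -(Complex.I / (hbar : ℂ)) ≠ 0 :=
  neg_ne_zero.mpr (div_ne_zero Complex.I_ne_zero (Complex.ofReal_ne_zero.mpr h))

theorem IsUnitaryGroupOf.dense_domain [CompleteSpace E] {hbar : ℝ} (hh : hbar ≠ 0)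
    {A : E →ₗ.[ℂ] E} {U : ℝ → (E ≃ₗᵢ[ℂ] E)} (h : IsUnitaryGroupOf hbar A U) :
    Dense (A.domain : Set E) := by
  refine h.isUnitaryGroup.dense_generator.mono ?_
  rintro x ⟨y, hy⟩
  refine LinearPMap.mem_domain_iff.mpr ⟨(-(Complex.I / (hbar : ℂ)))⁻¹ • y, ?_⟩
  rw [h.generator, smul_inv_smul₀ (neg_I_div_ne_zero hh)]
  exact hy

/-- The closure of a graph that is a core of the generator is the graph of the generator. -/
theorem IsUnitaryGroup.isUnitaryGroupOf_of_core [CompleteSpace E] {U : ℝ → (E ≃ₗᵢ[ℂ] E)}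
    (hU : IsUnitaryGroup U) {hbar : ℝ} (hh : hbar ≠ 0) {N : Submodule ℂ (E × E)}
    (hN : ∀ p ∈ N, HasDerivAt (fun t => U t p.1) ((-(Complex.I / (hbar : ℂ))) • p.2) 0)
    (hinv : ∀ t, ∀ p ∈ N, (U t p.1, U t p.2) ∈ N)
    (hd : Dense (Prod.fst '' (N : Set (E × E)))) :
    IsUnitaryGroupOf hbar N.topologicalClosure.toLinearPMap U := by
  have hc := neg_I_div_ne_zero hh
  have hmem := hU.mem_topologicalClosure_iff_of_core hc hN hinv hd
  refine ⟨hU.map_add, hU.continuous, fun x y => ?_⟩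
  rw [Submodule.toLinearPMap_graph_eq]
  · exact hmem (x, y)
  · intro p hp h0
    rw [hmem, h0] at hp
    simp only [_root_.map_zero] at hp
    exact (smul_eq_zero.mp (hp.unique (hasDerivAt_const _ _))).resolve_left hc

/-- Generators of unitarily equivalent unitary groups are unitarily equivalent. -/
theorem IsUnitaryGroupOf.eq_unitaryConj {hbar : ℝ} {A A' : E →ₗ.[ℂ] E}
    {U U' : ℝ → (E ≃ₗᵢ[ℂ] E)} (h : IsUnitaryGroupOf hbar A U) (h' : IsUnitaryGroupOf hbar A' U')
    (S : E ≃ₗᵢ[ℂ] E) (hS : ∀ t x, S (U t x) = U' t (S x)) : A' = unitaryConj S A := by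
  refine LinearPMap.eq_of_eq_graph ?_
  ext ⟨x, y⟩
  have h1 : (x, y) ∈ (unitaryConj S A).graph ↔ (S.symm x, S.symm y) ∈ A.graph := by
    simp only [LinearPMap.mem_graph_iff]
    constructor
    · rintro ⟨⟨z, hz⟩, rfl, hy⟩
      refine ⟨⟨S.symm z, hz⟩, rfl, ?_⟩
      rw [← hy]
      exact (S.symm_apply_apply _).symm
    · rintro ⟨⟨z, hz⟩, hx, hy⟩
      simp only at hx hy
      subst hx
      refine ⟨⟨x, hz⟩, rfl, ?_⟩
      rw [← S.symm.injective.eq_iff, ← hy]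
      exact S.symm_apply_apply _
  rw [h1, h.generator, h'.generator]
  -- One inclusion of graphs is enough, since it can be applied to `S` and to `S.symm`.
  have key : ∀ (S : E ≃ₗᵢ[ℂ] E) (U U' : ℝ → (E ≃ₗᵢ[ℂ] E)) (_ : ∀ t x, S (U t x) = U' t (S x))
      (x y : E), HasDerivAt (fun t => U t x) y 0 → HasDerivAt (fun t => U' t (S x)) (S y) 0 := by
    intro S U U' hS x y hx
    have := ((S.toContinuousLinearEquiv : E →L[ℂ] E).restrictScalars ℝ).hasFDerivAt.comp_hasDerivAt
      (0 : ℝ) hx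
    refine this.congr_of_eventuallyEq (Filter.Eventually.of_forall fun t => ?_)
    exact (hS t x).symm
  constructor
  · intro hx
    have := key S.symm U' U (fun t z => by
      rw [LinearIsometryEquiv.symm_apply_eq, hS, S.apply_symm_apply]) _ _ hx
    rwa [map_smul] at this
  · intro hx
    have := key S U U' hS _ _ hx
    rwa [map_smul, S.apply_symm_apply, S.apply_symm_apply] at this

end UnitaryGroups

/-! ### Resolvents of self-adjoint operators -/

section Resolvent

variable {E : Type*} [NormedAddCommGroup E] [InnerProductSpace ℂ E] [CompleteSpace E]

theorem inner_graph_of_isSelfAdjoint {A : E →ₗ.[ℂ] E} (hA : IsSelfAdjoint A) {p q : E × E}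
    (hp : p ∈ A.graph) (hq : q ∈ A.graph) : inner ℂ p.2 q.1 = inner ℂ p.1 q.2 := by
  have h := LinearPMap.adjoint_isFormalAdjoint hA.dense_domain
  rw [LinearPMap.isSelfAdjoint_def.mp hA] at h
  obtain ⟨x, hx, hx'⟩ := (LinearPMap.mem_graph_iff A).mp hp
  obtain ⟨y, hy, hy'⟩ := (LinearPMap.mem_graph_iff A).mp hq
  rw [← hx, ← hx', ← hy, ← hy']
  exact h x y

/-- This is the maximality `A* ⊆ A`, the half of self-adjointness that symmetry does not give. -/
theorem mem_graph_of_inner_eq {A : E →ₗ.[ℂ] E} (hA : IsSelfAdjoint A) {u v : E}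
    (h : ∀ p ∈ A.graph, inner ℂ v p.1 = inner ℂ u p.2) : (u, v) ∈ A.graph := by
  have h1 : ∀ x : A.domain, inner ℂ v (x : E) = inner ℂ u (A x) := fun x => h _ (A.mem_graph x)
  have h2 := LinearPMap.mem_adjoint_domain_of_exists u ⟨v, h1⟩
  have h3 := LinearPMap.adjoint_apply_eq hA.dense_domain ⟨u, h2⟩ h1
  have h4 : (u, v) ∈ A.adjoint.graph := (LinearPMap.mem_graph_iff _).mpr ⟨⟨u, h2⟩, rfl, h3⟩
  rwa [LinearPMap.isSelfAdjoint_def.mp hA] at h4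

/-- The cross term vanishes because `⟪A x, x⟫` is real. This bounds `A + i a` below on its domain.
-/
theorem norm_sq_add_smul {A : E →ₗ.[ℂ] E} (hA : IsSelfAdjoint A) (a : ℝ) {p : E × E}
    (hp : p ∈ A.graph) :
    ‖p.2 + (Complex.I * a) • p.1‖ ^ 2 = ‖p.2‖ ^ 2 + a ^ 2 * ‖p.1‖ ^ 2 := by
  have h := inner_graph_of_isSelfAdjoint hA hp hp
  have h1 : (inner ℂ p.2 p.1).im = 0 := by
    have h2 := inner_conj_symm (𝕜 := ℂ) p.2 p.1
    rw [← h] at h2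
    exact Complex.conj_eq_iff_im.mp h2
  rw [norm_add_sq (𝕜 := ℂ), inner_smul_right, norm_smul, mul_pow]
  simp [h1]

/-- `R = (A + i a)⁻¹`. -/
structure IsResolvent (A : E →ₗ.[ℂ] E) (a : ℝ) (R : E →L[ℂ] E) : Prop where
  mem_graph : ∀ z, (R z, z - (Complex.I * a) • R z) ∈ A.graph
  apply_graph : ∀ p ∈ A.graph, R (p.2 + (Complex.I * a) • p.1) = p.1
  norm_apply_le : ∀ z, ‖R z‖ ≤ |a|⁻¹ * ‖z‖

/-- As a map from the graph of `A`, the operator `A + i a` is bounded below, hence injective with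
closed range. A vector orthogonal to the range lies in the kernel of `A - i a`, which the same
estimate makes trivial. -/
theorem exists_isResolvent {A : E →ₗ.[ℂ] E} (hA : IsSelfAdjoint A) {a : ℝ} (ha : a ≠ 0) :
    ∃ R, IsResolvent A a R := by
  have hcl : IsClosed (A.graph : Set (E × E)) := hA.isClosed
  have : CompleteSpace A.graph := hcl.completeSpace_coe
  have ha' : 0 < |a| := abs_pos.mpr ha
  have hfst : ∀ (b : ℝ) (p : E × E), p ∈ A.graph →
      |b| * ‖p.1‖ ≤ ‖p.2 + (Complex.I * b) • p.1‖ := by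
    intro b p hp
    refine abs_le_of_sq_le_sq' ?_ (norm_nonneg _) |>.2
    rw [norm_sq_add_smul hA b hp, mul_pow, sq_abs]
    nlinarith [sq_nonneg ‖p.2‖]
  have hsnd : ∀ (p : E × E), p ∈ A.graph → ‖p.2‖ ≤ ‖p.2 + (Complex.I * a) • p.1‖ := by
    intro p hp
    refine abs_le_of_sq_le_sq' ?_ (norm_nonneg _) |>.2
    rw [norm_sq_add_smul hA a hp]
    nlinarith [mul_nonneg (sq_nonneg a) (sq_nonneg ‖p.1‖)]
  let T : A.graph →L[ℂ] E := (ContinuousLinearMap.snd ℂ E E +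
    (Complex.I * (a : ℂ)) • ContinuousLinearMap.fst ℂ E E).comp A.graph.subtypeL
  have hT : ∀ p : A.graph, T p = (p : E × E).2 + (Complex.I * a) • (p : E × E).1 := fun p => rfl
  have hanti : AntilipschitzWith (max 1 (Real.toNNReal |a|⁻¹)) T := by
    refine ContinuousLinearMap.antilipschitz_of_bound T fun p => ?_
    change ‖(p : E × E)‖ ≤ _ * ‖T p‖
    rw [Prod.norm_def]
    have h1 : (max 1 (Real.toNNReal |a|⁻¹) : NNReal) = max 1 |a|⁻¹ := by
      rw [NNReal.coe_max, Real.coe_toNNReal _ (inv_nonneg.mpr ha'.le), NNReal.coe_one]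
    rw [h1]
    refine max_le ?_ ?_
    · have h2 := hfst a p p.2
      rw [← hT] at h2
      calc ‖(p : E × E).1‖ ≤ |a|⁻¹ * ‖T p‖ := by
            rw [inv_mul_eq_div, le_div_iff₀ ha']; linarith
        _ ≤ _ := by gcongr; exact le_max_right _ _
    · have h2 := hsnd p p.2
      rw [← hT] at h2
      calc ‖(p : E × E).2‖ ≤ 1 * ‖T p‖ := by linarith
        _ ≤ _ := by gcongr; exact le_max_left _ _
  have hrange : IsClosed (T.toLinearMap.range : Set E) := by
    rw [LinearMap.coe_range]
    exact hanti.isClosed_range T.uniformContinuous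
  have hsurj : Function.Surjective T := by
    have : CompleteSpace T.toLinearMap.range := hrange.completeSpace_coe
    have h0 : T.toLinearMap.range = ⊤ := by
      rw [← Submodule.orthogonal_eq_bot_iff, Submodule.eq_bot_iff]
      intro u hu
      have h1 : ∀ p ∈ A.graph, inner ℂ ((Complex.I * a) • u) p.1 = inner ℂ u p.2 := by
        intro p hp
        have h2 := (Submodule.mem_orthogonal' _ _).mp hu (T ⟨p, hp⟩) ⟨⟨p, hp⟩, rfl⟩
        rw [hT, inner_add_right, inner_smul_right] at h2
        rw [inner_smul_left]
        simp only [map_mul, Complex.conj_I, Complex.conj_ofReal]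
        linear_combination -h2
      -- `h1` and maximality give `A u = i a u`; the lower bound for `-a` forces `u = 0`.
      have h3 := hfst (-a) _ (mem_graph_of_inner_eq hA h1)
      have h4 : (Complex.I * (a : ℂ)) • u + (Complex.I * ((-a : ℝ) : ℂ)) • u = 0 := by
        rw [← add_smul]; push_cast; ring_nf; simp
      rw [h4, norm_zero, abs_neg] at h3
      have h5 : ‖u‖ ≤ 0 := by
        by_contra! h
        nlinarith [mul_pos ha' h]
      simpa using h5
    intro z
    have : z ∈ T.toLinearMap.range := h0 ▸ Submodule.mem_top
    exact this
  let e : A.graph ≃ₗ[ℂ] E := LinearEquiv.ofBijective T.toLinearMap ⟨hanti.injective, hsurj⟩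
  have he : ∀ p, e p = T p := fun p => rfl
  let R₀ : E →ₗ[ℂ] E := LinearMap.fst ℂ E E ∘ₗ A.graph.subtype ∘ₗ (e.symm : E →ₗ[ℂ] A.graph)
  have hR₀ : ∀ z, ‖R₀ z‖ ≤ |a|⁻¹ * ‖z‖ := by
    intro z
    have h1 := hfst a (e.symm z) (e.symm z).2
    rw [← hT, ← he, e.apply_symm_apply] at h1
    rw [inv_mul_eq_div, le_div_iff₀ ha', mul_comm]
    exact h1
  refine ⟨R₀.mkContinuous _ hR₀, fun z => ?_, fun p hp => ?_, hR₀⟩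
  · have h1 := e.apply_symm_apply z
    rw [he, hT] at h1
    have h2 : (R₀ z, z - (Complex.I * a) • R₀ z) = (e.symm z : E × E) := by
      refine Prod.ext rfl ?_
      change z - (Complex.I * a) • (e.symm z : E × E).1 = _
      exact sub_eq_of_eq_add h1.symm
    change (R₀ z, z - (Complex.I * a) • R₀ z) ∈ A.graph
    rw [h2]
    exact (e.symm z).2
  · change ((e.symm (e ⟨p, hp⟩) : A.graph) : E × E).1 = p.1
    rw [e.symm_apply_apply]

/-! ### Adjoints, commutation and strong limits of resolvents -/

namespace IsResolvent

variable {A : E →ₗ.[ℂ] E} {a b : ℝ} {R R' : E →L[ℂ] E}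

theorem inner_apply (hA : IsSelfAdjoint A) (hR : IsResolvent A a R) (hR' : IsResolvent A (-a) R')
    (z w : E) : inner ℂ (R z) w = inner ℂ z (R' w) := by
  have h := inner_graph_of_isSelfAdjoint hA (hR.mem_graph z) (hR'.mem_graph w)
  simp only [inner_sub_left, inner_sub_right, inner_smul_left, inner_smul_right, map_mul,
    Complex.conj_I, Complex.conj_ofReal] at h
  push_cast at h
  linear_combination -h

-- Each resolvent maps the graph of `A` into itself, componentwise. Writing `z` as `(A + i a) p.1`
-- then reduces both products to `R' p.1`.
omit [CompleteSpace E] in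
theorem commute (hR : IsResolvent A a R) (hR' : IsResolvent A b R') : Commute R R' := by
  ext z
  change R (R' z) = R' (R z)
  obtain ⟨p, hp, hz⟩ : ∃ p ∈ A.graph, z = p.2 + (Complex.I * a) • p.1 :=
    ⟨_, hR.mem_graph z, by simp⟩
  have h1 : (R' p.1, R' p.2) ∈ A.graph := by
    have h2 := hR'.apply_graph p hp
    have h3 := hR'.mem_graph p.1
    have h4 : p.1 - (Complex.I * b) • R' p.1 = R' p.2 := by
      rw [map_add, map_smul] at h2
      exact sub_eq_of_eq_add h2.symm
    rwa [h4] at h3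
  have h5 := hR.apply_graph _ h1
  rw [hz, hR.apply_graph p hp, map_add, map_smul, h5]

omit [CompleteSpace E] in
/-- `i a (A + i a)⁻¹ → 1` strongly as `a → ∞`. -/
theorem norm_sub_smul_apply_le (hR : IsResolvent A a R) {p : E × E} (hp : p ∈ A.graph) :
    ‖(Complex.I * a) • R p.1 - p.1‖ ≤ |a|⁻¹ * ‖p.2‖ := by
  have h := hR.apply_graph p hp
  rw [map_add, map_smul] at h
  have h1 : (Complex.I * a) • R p.1 - p.1 = -R p.2 := by
    rw [sub_eq_iff_eq_add]
    nth_rw 2 [← h]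
    abel
  rw [h1, norm_neg]
  exact hR.norm_apply_le _

end IsResolvent

/-- The operators `i a (A + i a)⁻¹` are contractions, so convergence on the dense domain of `A`
extends to the whole space. -/
theorem tendsto_smul_resolvent {A : E →ₗ.[ℂ] E} (hA : IsSelfAdjoint A) {a : ℕ → ℝ}
    (ha : Filter.Tendsto (fun n => |a n|) Filter.atTop Filter.atTop) {R : ℕ → (E →L[ℂ] E)}
    (hR : ∀ n, IsResolvent A (a n) (R n)) (x : E) :
    Filter.Tendsto (fun n => (Complex.I * a n) • R n x) Filter.atTop (nhds x) := by
  have hb : ∀ n z, ‖(Complex.I * a n) • R n z‖ ≤ ‖z‖ := by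
    intro n z
    rw [norm_smul, norm_mul, Complex.norm_I, one_mul, Complex.norm_real, Real.norm_eq_abs]
    rcases eq_or_ne (a n) 0 with h | h
    · simp [h]
    · have h1 := mul_le_mul_of_nonneg_left ((hR n).norm_apply_le z) (abs_nonneg (a n))
      rwa [mul_inv_cancel_left₀ (abs_ne_zero.mpr h)] at h1
  rw [Metric.tendsto_atTop]
  intro ε hε
  obtain ⟨x', hx', hd⟩ := Metric.mem_closure_iff.mp (hA.dense_domain x) (ε / 3) (by positivity)
  obtain ⟨y, hy⟩ := LinearPMap.mem_domain_iff.mp hx'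
  have h0 : Filter.Tendsto (fun n => |a n|⁻¹ * ‖y‖) Filter.atTop (nhds 0) := by
    simpa using ha.inv_tendsto_atTop.mul_const ‖y‖
  obtain ⟨N, hN⟩ := Filter.eventually_atTop.mp
    (h0.eventually (gt_mem_nhds (by positivity : 0 < ε / 3)))
  refine ⟨N, fun n hn => ?_⟩
  have h1 := (hR n).norm_sub_smul_apply_le hy
  have h2 := hN n hn
  rw [dist_eq_norm] at hd ⊢
  have h3 : (Complex.I * a n) • R n x - x = (Complex.I * a n) • R n (x - x') +
      ((Complex.I * a n) • R n x' - x') - (x - x') := by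
    rw [map_sub, smul_sub]; abel
  rw [h3]
  calc _ ≤ ‖(Complex.I * a n) • R n (x - x')‖ + ‖(Complex.I * a n) • R n x' - x'‖ + ‖x - x'‖ :=
        (norm_sub_le _ _).trans (by gcongr; exact norm_add_le _ _)
    _ < ε := by
        have := hb n (x - x')
        simp only at h1 h2
        linarith

/-- Bounded self-adjoint approximations of a self-adjoint operator. -/
theorem exists_approximation {A : E →ₗ.[ℂ] E} (hA : IsSelfAdjoint A) :
    ∃ C : ℕ → selfAdjoint (E →L[ℂ] E), (∀ m n, Commute (C m : E →L[ℂ] E) (C n)) ∧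
      ∀ p ∈ A.graph, Filter.Tendsto (fun n => (C n : E →L[ℂ] E) p.1) Filter.atTop (nhds p.2) := by
  have hpos : ∀ n : ℕ, ((n : ℝ) + 1) ≠ 0 := fun n => by positivity
  choose R hR using fun n : ℕ => exists_isResolvent hA (hpos n)
  choose Q hQ using fun n : ℕ => exists_isResolvent hA (neg_ne_zero.mpr (hpos n))
  -- With `a = n + 1`, the operator `(a² / 2) ((A + i a)⁻¹ + (A - i a)⁻¹)` equals `a² A (A² +
  -- a²)⁻¹`: bounded, self-adjoint and formally tending to `A`.
  let r : ℕ → ℝ := fun n => (n + 1) ^ 2 / 2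
  have hsa : ∀ n, IsSelfAdjoint ((r n : ℂ) • (R n + Q n)) := by
    intro n
    rw [ContinuousLinearMap.isSelfAdjoint_iff_isSymmetric]
    intro x y
    have h1 := (hR n).inner_apply hA (hQ n) x y
    have h2 := (hQ n).inner_apply hA (R' := R n) (by rw [neg_neg]; exact hR n) x y
    simp only [ContinuousLinearMap.coe_coe, smul_apply,
      add_apply, inner_smul_left, inner_smul_right, inner_add_left,
      inner_add_right, h1, h2, Complex.conj_ofReal]
    ring
  refine ⟨fun n => ⟨_, hsa n⟩, fun m n => ?_, fun p hp => ?_⟩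
  · have h1 := ((hR m).commute (hR n)).add_right ((hR m).commute (hQ n))
    have h2 := ((hQ m).commute (hR n)).add_right ((hQ m).commute (hQ n))
    have h3 := ((h1.add_left h2).smul_left (r m : ℂ)).smul_right (r n : ℂ)
    exact h3
  · have hn : Filter.Tendsto (fun n : ℕ => |(n : ℝ) + 1|) Filter.atTop Filter.atTop :=
      Filter.tendsto_abs_atTop_atTop.comp
        (Filter.tendsto_atTop_add_const_right _ 1 tendsto_natCast_atTop_atTop)
    have h1 := tendsto_smul_resolvent hA hn hR p.2
    have h2 := tendsto_smul_resolvent hA (a := fun n => -((n : ℝ) + 1))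
      (by simpa only [abs_neg] using hn) hQ p.2
    -- On the domain of `A` the approximation equals `½ (i a (A + i a)⁻¹ - i a (A - i a)⁻¹) A`, to
    -- which the strong limits apply.
    have h3 := (h1.add h2).const_smul (1 / 2 : ℂ)
    rw [← two_smul ℂ p.2, smul_smul, one_div, inv_mul_cancel₀ two_ne_zero, one_smul] at h3
    refine h3.congr fun n => ?_
    have h4 := (hR n).apply_graph p hp
    have h5 := (hQ n).apply_graph p hp
    rw [map_add, map_smul, ← eq_sub_iff_add_eq] at h4 h5
    change _ = ((r n : ℝ) : ℂ) • (R n p.1 + Q n p.1)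
    rw [h4, h5]
    simp only [r]
    push_cast
    match_scalars
    · ring
    · linear_combination (-(n + 1 : ℂ) ^ 2 / 2) * Complex.I_mul_I
    · linear_combination (-(n + 1 : ℂ) ^ 2 / 2) * Complex.I_mul_I

end Resolvent

/-! ### Stone's theorem: self-adjoint operators generate unitary groups -/

section Stone

open Filter

variable {E : Type*} [NormedAddCommGroup E] [InnerProductSpace ℂ E] [CompleteSpace E]

/-- The unitary group `exp(-(i/ℏ) t C)` of a bounded self-adjoint operator. -/
def boundedEvolution (hbar : ℝ) (C : selfAdjoint (E →L[ℂ] E)) (t : ℝ) : E ≃ₗᵢ[ℂ] E :=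
  Unitary.linearIsometryEquiv (selfAdjoint.expUnitary ((-t / hbar) • C))

theorem boundedEvolution_apply (hbar : ℝ) (C : selfAdjoint (E →L[ℂ] E)) (t : ℝ) (x : E) :
    boundedEvolution hbar C t x =
      NormedSpace.exp ((t : ℂ) • ((-(Complex.I / (hbar : ℂ))) • (C : E →L[ℂ] E))) x := by
  change ((selfAdjoint.expUnitary ((-t / hbar) • C) : unitary (E →L[ℂ] E)) : E →L[ℂ] E) x = _
  rw [selfAdjoint.expUnitary_coe, selfAdjoint.val_smul, ← Complex.coe_smul, smul_smul, smul_smul]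
  congr 3
  push_cast
  ring

theorem boundedEvolution_add_left (hbar : ℝ) {C D : selfAdjoint (E →L[ℂ] E)}
    (h : Commute (C : E →L[ℂ] E) (D : E →L[ℂ] E)) (t : ℝ) (x : E) :
    boundedEvolution hbar (C + D) t x =
      boundedEvolution hbar C t (boundedEvolution hbar D t x) := by
  have h1 : Commute (((-t / hbar) • C : selfAdjoint (E →L[ℂ] E)) : E →L[ℂ] E)
      ((-t / hbar) • D : selfAdjoint (E →L[ℂ] E)) := by
    rw [selfAdjoint.val_smul, selfAdjoint.val_smul]
    exact (h.smul_left _).smul_right _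
  have h2 : (-t / hbar) • (C + D) = (-t / hbar) • C + (-t / hbar) • D := Subtype.ext (by
    rw [AddSubgroup.coe_add, selfAdjoint.val_smul, selfAdjoint.val_smul, selfAdjoint.val_smul,
      AddSubgroup.coe_add]
    exact smul_add _ (C : E →L[ℂ] E) (D : E →L[ℂ] E))
  simp only [boundedEvolution, h2, h1.expUnitary_add, map_mul]
  rfl

theorem boundedEvolution_add (hbar : ℝ) (C : selfAdjoint (E →L[ℂ] E)) (s t : ℝ) (x : E) :
    boundedEvolution hbar C (s + t) x =
      boundedEvolution hbar C s (boundedEvolution hbar C t x) := by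
  have h1 : Commute (((-s / hbar) • C : selfAdjoint (E →L[ℂ] E)) : E →L[ℂ] E)
      ((-t / hbar) • C : selfAdjoint (E →L[ℂ] E)) := by
    rw [selfAdjoint.val_smul, selfAdjoint.val_smul]
    exact ((Commute.refl _).smul_left _).smul_right _
  have h2 : (-(s + t) / hbar) • C = (-s / hbar) • C + (-t / hbar) • C := Subtype.ext (by
    rw [AddSubgroup.coe_add, selfAdjoint.val_smul, selfAdjoint.val_smul, selfAdjoint.val_smul,
      neg_add, add_div]
    exact add_smul _ _ (C : E →L[ℂ] E))
  simp only [boundedEvolution, h2, h1.expUnitary_add, map_mul]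
  rfl

theorem boundedEvolution_zero (hbar : ℝ) (C : selfAdjoint (E →L[ℂ] E)) (x : E) :
    boundedEvolution hbar C 0 x = x := by
  rw [boundedEvolution_apply]
  simp

theorem hasDerivAt_boundedEvolution (hbar : ℝ) (C : selfAdjoint (E →L[ℂ] E)) (x : E) (t : ℝ) :
    HasDerivAt (fun t => boundedEvolution hbar C t x)
      (boundedEvolution hbar C t ((-(Complex.I / (hbar : ℂ))) • (C : E →L[ℂ] E) x)) t := by
  simp only [boundedEvolution_apply]
  have h := hasDerivAt_exp_smul_const (𝕂 := ℂ)
    ((-(Complex.I / (hbar : ℂ))) • (C : E →L[ℂ] E)) (t : ℂ)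
  have h2 := (ContinuousLinearMap.apply ℂ E x).hasFDerivAt.comp_hasDerivAt (t : ℂ) h
  have h3 := h2.scomp t Complex.ofRealCLM.hasDerivAt
  rw [Complex.ofRealCLM_apply, Complex.ofReal_one, one_smul] at h3
  exact h3

theorem norm_neg_I_div (hbar : ℝ) : ‖-(Complex.I / (hbar : ℂ))‖ = |hbar|⁻¹ := by
  rw [norm_neg, norm_div, Complex.norm_I, Complex.norm_real, Real.norm_eq_abs, one_div]

/-- Mean value inequality: the velocity has constant norm, because the evolution is isometric. -/
theorem norm_boundedEvolution_sub_le (hbar : ℝ) (C : selfAdjoint (E →L[ℂ] E)) (t : ℝ) (x : E) :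
    ‖boundedEvolution hbar C t x - x‖ ≤ |hbar|⁻¹ * ‖(C : E →L[ℂ] E) x‖ * |t| := by
  have h := Convex.norm_image_sub_le_of_norm_hasDerivWithin_le (s := Set.univ)
    (f := fun t => boundedEvolution hbar C t x) (C := |hbar|⁻¹ * ‖(C : E →L[ℂ] E) x‖)
    (fun t _ => (hasDerivAt_boundedEvolution hbar C x t).hasDerivWithinAt)
    (fun t _ => by rw [LinearIsometryEquiv.norm_map, norm_smul, norm_neg_I_div])
    convex_univ (Set.mem_univ 0) (Set.mem_univ t)
  simpa [boundedEvolution_zero] using h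

/-- Commutation lets the evolution of `C` factor as that of `D` after that of `C - D`, which reduces
the comparison to a single group. This is the Cauchy estimate for the approximating groups in
Stone's theorem. -/
theorem norm_boundedEvolution_sub_boundedEvolution_le (hbar : ℝ) {C D : selfAdjoint (E →L[ℂ] E)}
    (h : Commute (C : E →L[ℂ] E) (D : E →L[ℂ] E)) (t : ℝ) (x : E) :
    ‖boundedEvolution hbar C t x - boundedEvolution hbar D t x‖ ≤
      |hbar|⁻¹ * ‖(C : E →L[ℂ] E) x - (D : E →L[ℂ] E) x‖ * |t| := by
  have h1 : boundedEvolution hbar C t x =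
      boundedEvolution hbar D t (boundedEvolution hbar (C - D) t x) := by
    rw [← boundedEvolution_add_left, add_sub_cancel]
    rw [AddSubgroupClass.coe_sub]
    exact h.symm.sub_right (Commute.refl _)
  rw [h1, ← map_sub, LinearIsometryEquiv.norm_map]
  exact norm_boundedEvolution_sub_le hbar (C - D) t x

omit [CompleteSpace E] in
/-- Strong limits of unitary groups are unitary groups. -/
theorem exists_limit_group {V : ℕ → ℝ → (E ≃ₗᵢ[ℂ] E)}
    (hadd : ∀ n s t x, V n (s + t) x = V n s (V n t x)) (hzero : ∀ n x, V n 0 x = x)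
    {u : ℝ → E → E} (hu : ∀ t x, Tendsto (fun n => V n t x) atTop (nhds (u t x))) :
    ∃ U : ℝ → (E ≃ₗᵢ[ℂ] E), (∀ s t x, U (s + t) x = U s (U t x)) ∧ ∀ t x, U t x = u t x := by
  have h0 : ∀ x, u 0 x = x := fun x =>
    tendsto_nhds_unique (hu 0 x) (by simp only [hzero]; exact tendsto_const_nhds)
  have hcomp : ∀ s t x, u (s + t) x = u s (u t x) := by
    intro s t x
    refine tendsto_nhds_unique (hu (s + t) x) ?_
    -- Isometry makes the convergence at time `s` insensitive to the moving argument `V n t x`.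
    have h1 : Tendsto (fun n => V n s (V n t x - u t x)) atTop (nhds 0) := by
      rw [tendsto_zero_iff_norm_tendsto_zero]
      simp only [LinearIsometryEquiv.norm_map]
      exact tendsto_iff_norm_sub_tendsto_zero.mp (hu t x)
    have h2 := h1.add (hu s (u t x))
    simpa [← hadd] using h2
  let L : ℝ → (E →ₗᵢ[ℂ] E) := fun t =>
    { toFun := u t
      map_add' := fun x y => tendsto_nhds_unique (hu t (x + y)) (by
        simpa only [map_add] using (hu t x).add (hu t y))
      map_smul' := fun c x => tendsto_nhds_unique (hu t (c • x)) (by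
        simpa only [map_smul, RingHom.id_apply] using (hu t x).const_smul c)
      norm_map' := fun x => tendsto_nhds_unique (hu t x).norm (by
        simp only [LinearIsometryEquiv.norm_map]; exact tendsto_const_nhds) }
  refine ⟨fun t => LinearIsometryEquiv.ofSurjective (L t) fun x => ⟨u (-t) x, ?_⟩,
    hcomp, fun _ _ => rfl⟩
  change u t (u (-t) x) = x
  rw [← hcomp, add_neg_cancel, h0]

/-- Stone's theorem by approximation: the groups of the commuting bounded operators `C n` are Cauchy
on the domain of `A`, hence everywhere by isometry, and their strong limit is the required group. -/
theorem exists_isUnitaryGroupOf {hbar : ℝ} (hh : hbar ≠ 0) {A : E →ₗ.[ℂ] E}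
    (hA : IsSelfAdjoint A) : ∃ U, IsUnitaryGroupOf hbar A U := by
  obtain ⟨C, hcomm, hlim⟩ := exists_approximation hA
  set V : ℕ → ℝ → (E ≃ₗᵢ[ℂ] E) := fun n => boundedEvolution hbar (C n)
  set c := -(Complex.I / (hbar : ℂ)) with hc
  have hconv : ∀ t x, ∃ y, Tendsto (fun n => V n t x) atTop (nhds y) := by
    intro t x
    refine cauchySeq_tendsto_of_complete ?_
    rw [Metric.cauchySeq_iff]
    intro ε hε
    obtain ⟨x', hx', hd⟩ := Metric.mem_closure_iff.mp (hA.dense_domain x) (ε / 3) (by positivity)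
    obtain ⟨y, hy⟩ := LinearPMap.mem_domain_iff.mp hx'
    -- The `+ 1` keeps the denominator positive at `t = 0`.
    obtain ⟨N, hN⟩ := Metric.cauchySeq_iff.mp (hlim _ hy).cauchySeq
      (ε / 3 / (|hbar|⁻¹ * |t| + 1)) (by positivity)
    refine ⟨N, fun m hm n hn => ?_⟩
    have h1 := norm_boundedEvolution_sub_boundedEvolution_le hbar (hcomm m n) t x'
    have h2 := hN m hm n hn
    rw [dist_eq_norm] at h2 hd ⊢
    have h3 : V m t x - V n t x = V m t (x - x') + (V m t x' - V n t x') - V n t (x - x') := by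
      simp only [map_sub]; abel
    have h4 : ‖V m t x' - V n t x'‖ ≤ ε / 3 := by
      rw [lt_div_iff₀ (by positivity)] at h2
      refine h1.trans ?_
      have : 0 ≤ ‖(C m : E →L[ℂ] E) x' - (C n : E →L[ℂ] E) x'‖ := norm_nonneg _
      simp only at h2
      nlinarith
    rw [h3]
    calc _ ≤ ‖V m t (x - x')‖ + ‖V m t x' - V n t x'‖ + ‖V n t (x - x')‖ :=
          (norm_sub_le _ _).trans (by gcongr; exact norm_add_le _ _)
      _ < ε := by
          rw [LinearIsometryEquiv.norm_map, LinearIsometryEquiv.norm_map]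
          linarith
  choose u hu using hconv
  obtain ⟨U, hUadd, hUu⟩ := exists_limit_group (V := V)
    (fun n => boundedEvolution_add hbar (C n)) (fun n => boundedEvolution_zero hbar (C n)) hu
  have hUlim : ∀ t x, Tendsto (fun n => V n t x) atTop (nhds (U t x)) := fun t x =>
    hUu t x ▸ hu t x
  have hU0 : ∀ x, U 0 x = x := fun x => (U 0).injective (by rw [← hUadd, add_zero])
  have hlip : ∀ p ∈ A.graph, ∀ s t, ‖U s p.1 - U t p.1‖ ≤ |hbar|⁻¹ * ‖p.2‖ * |s - t| := by
    intro p hp s t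
    have h1 : ‖U (s - t) p.1 - p.1‖ ≤ |hbar|⁻¹ * ‖p.2‖ * |s - t| :=
      le_of_tendsto_of_tendsto' ((hUlim _ _).sub_const _).norm
        (((hlim p hp).norm.const_mul _).mul_const _)
        fun n => norm_boundedEvolution_sub_le hbar (C n) _ _
    have h2 : U s p.1 = U t (U (s - t) p.1) := by rw [← hUadd, add_sub_cancel]
    rwa [h2, ← map_sub, LinearIsometryEquiv.norm_map]
  have hcont0 : ∀ p ∈ A.graph, Continuous fun t => U t p.1 := fun p hp =>
    (LipschitzWith.of_dist_le_mul (K := Real.toNNReal (|hbar|⁻¹ * ‖p.2‖)) fun s t => by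
      rw [dist_eq_norm, dist_eq_norm, Real.norm_eq_abs, Real.coe_toNNReal _ (by positivity)]
      exact hlip p hp s t).continuous
  have hcont : ∀ x, Continuous fun t => U t x := by
    intro x
    refine hA.dense_domain.induction (fun x hx => ?_) (isClosed_setOf_continuous_orbit U) x
    obtain ⟨y, hy⟩ := LinearPMap.mem_domain_iff.mp hx
    exact hcont0 _ hy
  have hUg : IsUnitaryGroup U := ⟨hUadd, hcont⟩
  have hgen : ∀ x y, (x, y) ∈ A.graph → HasDerivAt (fun t => U t x) (c • y) 0 := by
    intro x y hxy
    rw [hUg.hasDerivAt_zero_iff]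
    intro t
    have h1 : ∀ n, V n t x - x = ∫ s in (0 : ℝ)..t, V n s (c • (C n : E →L[ℂ] E) x) := by
      intro n
      have hd := hasDerivAt_boundedEvolution hbar (C n)
      have hcn : Continuous fun s => V n s (c • (C n : E →L[ℂ] E) x) :=
        continuous_iff_continuousAt.mpr fun s => (hd _ s).continuousAt
      rw [intervalIntegral.integral_eq_sub_of_hasDerivAt (fun s _ => hd x s)
        (hcn.intervalIntegrable _ _), boundedEvolution_zero]
    have h2 : Tendsto (fun n => V n t x - x) atTop (nhds (U t x - x)) := (hUlim t x).sub_const x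
    refine tendsto_nhds_unique h2 ?_
    simp only [h1]
    have hlim' := (hlim _ hxy).const_smul c
    -- The integrand's norm `‖c • C n x‖` does not depend on `s` and is eventually below `‖c • y‖ +
    -- 1`.
    refine intervalIntegral.tendsto_integral_filter_of_dominated_convergence
      (fun _ => ‖c • y‖ + 1) ?_ ?_ ?_ ?_
    · refine Eventually.of_forall fun n => Continuous.aestronglyMeasurable ?_
      exact continuous_iff_continuousAt.mpr fun s =>
        (hasDerivAt_boundedEvolution hbar (C n) _ s).continuousAt
    · filter_upwards [hlim'.norm.eventually (gt_mem_nhds (lt_add_one _))] with n hn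
      refine Eventually.of_forall fun s _ => ?_
      rw [LinearIsometryEquiv.norm_map]
      exact hn.le
    · exact intervalIntegrable_const
    · refine Eventually.of_forall fun s _ => ?_
      have h3 : Tendsto (fun n => V n s (c • (C n : E →L[ℂ] E) x - c • y)) atTop (nhds 0) := by
        rw [tendsto_zero_iff_norm_tendsto_zero]
        simp only [LinearIsometryEquiv.norm_map]
        exact tendsto_iff_norm_sub_tendsto_zero.mp hlim'
      simpa only [map_sub, sub_add_cancel, zero_add] using h3.add (hUlim s (c • y))
  refine ⟨U, hUadd, hcont, fun x y => ⟨hgen x y, fun hxy => ?_⟩⟩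
  refine mem_graph_of_inner_eq hA fun p hp => ?_
  -- `⟪U t x, U t p.1⟫` is constant in `t`; its vanishing derivative says `⟪y, p.1⟫ = ⟪x, p.2⟫`, so
  -- the generator cannot exceed `A`.
  have h1 := HasDerivAt.inner ℂ hxy (hgen p.1 p.2 hp)
  simp only [LinearIsometryEquiv.inner_map_map, hU0] at h1
  have h2 := h1.unique (hasDerivAt_const _ _)
  rw [inner_smul_left, inner_smul_right] at h2
  have h3 : conj c = -c := by simp [hc, neg_div]
  rw [h3] at h2
  have h4 : c * (inner ℂ y p.1 - inner ℂ x p.2) = 0 := by linear_combination -h2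
  exact sub_eq_zero.mp ((mul_eq_zero.mp h4).resolve_left (neg_I_div_ne_zero hh))

theorem isUnitaryGroupOf_evolution {hbar : ℝ} (hh : hbar ≠ 0) {A : E →ₗ.[ℂ] E}
    (hA : IsSelfAdjoint A) : IsUnitaryGroupOf hbar A (evolution hbar A) := by
  have h := exists_isUnitaryGroupOf hh hA
  rw [evolution, dif_pos h]
  exact h.choose_spec

end Stone

/-! ### Translations and multiplication operators on `L²(ℝ; E)` -/

section WaveSpace

variable {E : Type*} [NormedAddCommGroup E] [InnerProductSpace ℂ E]

variable (E) in
/-- The space `L²(ℝ; E)` of wave functions. -/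
abbrev WaveSpace : Type _ := Lp E 2 (volume : Measure ℝ)

theorem translateIsometry_coeFn (t : ℝ) (F : WaveSpace E) :
    Lp.compMeasurePreservingₗᵢ ℂ (fun τ : ℝ => τ - t) (measurePreserving_sub_right volume t) F
      =ᵐ[volume] fun τ => F (τ - t) :=
  Lp.coeFn_compMeasurePreserving F (measurePreserving_sub_right volume t)

theorem ae_comp_sub {P : ℝ → Prop} (h : ∀ᵐ τ, P τ) (t : ℝ) : ∀ᵐ τ, P (τ - t) :=
  (measurePreserving_sub_right (volume : Measure ℝ) t).quasiMeasurePreserving.ae h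

/-- The translation `F ↦ F(· - t)`. -/
def translate (t : ℝ) : WaveSpace E ≃ₗᵢ[ℂ] WaveSpace E :=
  LinearIsometryEquiv.ofSurjective
    (Lp.compMeasurePreservingₗᵢ ℂ (fun τ : ℝ => τ - t) (measurePreserving_sub_right volume t))
    fun F => ⟨Lp.compMeasurePreservingₗᵢ ℂ (fun τ : ℝ => τ - -t)
      (measurePreserving_sub_right volume (-t)) F, by
        refine Lp.ext ?_
        filter_upwards [translateIsometry_coeFn t (Lp.compMeasurePreservingₗᵢ ℂ
          (fun τ : ℝ => τ - -t) (measurePreserving_sub_right volume (-t)) F),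
          ae_comp_sub (translateIsometry_coeFn (-t) F) t] with τ h1 h2
        rw [h1, h2, sub_neg_eq_add, sub_add_cancel]⟩

theorem translate_coeFn (t : ℝ) (F : WaveSpace E) :
    translate t F =ᵐ[volume] fun τ => F (τ - t) :=
  translateIsometry_coeFn t F

theorem isUnitaryGroup_translate : IsUnitaryGroup (translate : ℝ → WaveSpace E ≃ₗᵢ[ℂ] _) where
  map_add s t F := by
    refine Lp.ext ?_
    filter_upwards [translate_coeFn (s + t) F, translate_coeFn s (translate t F),
      ae_comp_sub (translate_coeFn t F) s] with τ h1 h2 h3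
    rw [h1, h2, h3, sub_sub]
  continuous F := by
    have hg : Continuous fun t : ℝ => (⟨fun τ => τ - t, by fun_prop⟩ : C(ℝ, ℝ)) :=
      ContinuousMap.continuous_of_continuous_uncurry _ (by
        change Continuous fun p : ℝ × ℝ => p.2 - p.1
        fun_prop)
    exact Continuous.compMeasurePreservingLp (continuous_const (y := F)) hg
      (fun t => measurePreserving_sub_right volume t) (by norm_num)

/-- Applying `V t` turns the difference of the inverses into `x - V t ((V t₀).symm x)`, where strong
continuity of `V` itself applies. -/
theorem continuous_symm_of_isometry {X : Type*} [TopologicalSpace X] {V : X → (E ≃ₗᵢ[ℂ] E)}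
    (hV : ∀ x, Continuous fun t => V t x) (x : E) : Continuous fun t => (V t).symm x := by
  rw [continuous_iff_continuousAt]
  intro t₀
  rw [ContinuousAt, tendsto_iff_norm_sub_tendsto_zero]
  have h1 : ∀ t, ‖(V t).symm x - (V t₀).symm x‖ = ‖V t ((V t₀).symm x) - x‖ := by
    intro t
    rw [← (V t).norm_map, map_sub, (V t).apply_symm_apply, norm_sub_rev]
  simp only [h1]
  have h2 := ((hV ((V t₀).symm x)).sub (continuous_const (y := x))).norm.tendsto t₀
  simpa using h2

/-- Measurability comes from the joint continuity of `(τ, v) ↦ V τ v`; strong continuity suffices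
for that because each `V τ` is isometric. -/
theorem memLp_isometry_apply {V : ℝ → (E ≃ₗᵢ[ℂ] E)} (hV : ∀ x, Continuous fun t => V t x)
    (F : WaveSpace E) : MemLp (fun τ => V τ (F τ)) 2 (volume : Measure ℝ) := by
  refine (Lp.memLp F).of_le ?_ (Filter.Eventually.of_forall fun τ => by simp)
  exact (continuous_uncurry_of_isometry hV).comp_aestronglyMeasurable
    (aestronglyMeasurable_id.prodMk (Lp.aestronglyMeasurable F))

/-- Pointwise application of a strongly continuous family of unitary operators. -/
def pointwiseIsometry (V : ℝ → (E ≃ₗᵢ[ℂ] E)) (hV : ∀ x, Continuous fun t => V t x) :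
    WaveSpace E →ₗᵢ[ℂ] WaveSpace E where
  toFun F := (memLp_isometry_apply hV F).toLp _
  map_add' F G := by
    refine Lp.ext ?_
    filter_upwards [(memLp_isometry_apply hV (F + G)).coeFn_toLp,
      (memLp_isometry_apply hV F).coeFn_toLp, (memLp_isometry_apply hV G).coeFn_toLp,
      Lp.coeFn_add F G, Lp.coeFn_add ((memLp_isometry_apply hV F).toLp _)
        ((memLp_isometry_apply hV G).toLp _)] with τ h1 h2 h3 h4 h5
    rw [h1, h5, Pi.add_apply, h2, h3, h4, Pi.add_apply, map_add]
  map_smul' c F := by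
    refine Lp.ext ?_
    filter_upwards [(memLp_isometry_apply hV (c • F)).coeFn_toLp,
      (memLp_isometry_apply hV F).coeFn_toLp, Lp.coeFn_smul c F,
      Lp.coeFn_smul c ((memLp_isometry_apply hV F).toLp _)] with τ h1 h2 h3 h4
    rw [RingHom.id_apply, h1, h4, Pi.smul_apply, h2, h3, Pi.smul_apply, map_smul]
  norm_map' F := by
    have h : ∀ᵐ τ, ‖(memLp_isometry_apply hV F).toLp _ τ‖ = ‖F τ‖ := by
      filter_upwards [(memLp_isometry_apply hV F).coeFn_toLp] with τ h
      rw [h, LinearIsometryEquiv.norm_map]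
    exact le_antisymm (Lp.norm_le_norm_of_ae_le (h.mono fun _ h => h.le))
      (Lp.norm_le_norm_of_ae_le (h.mono fun _ h => h.ge))

theorem pointwiseIsometry_coeFn {V : ℝ → (E ≃ₗᵢ[ℂ] E)} (hV : ∀ x, Continuous fun t => V t x)
    (F : WaveSpace E) : pointwiseIsometry V hV F =ᵐ[volume] fun τ => V τ (F τ) :=
  (memLp_isometry_apply hV F).coeFn_toLp

/-- The unitary operator `F ↦ (τ ↦ V(τ) F(τ))`. -/
def pointwise (V : ℝ → (E ≃ₗᵢ[ℂ] E)) (hV : ∀ x, Continuous fun t => V t x) :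
    WaveSpace E ≃ₗᵢ[ℂ] WaveSpace E :=
  LinearIsometryEquiv.ofSurjective (pointwiseIsometry V hV) fun F =>
    ⟨pointwiseIsometry (fun τ => (V τ).symm) (continuous_symm_of_isometry hV) F, by
      refine Lp.ext ?_
      filter_upwards [pointwiseIsometry_coeFn hV (pointwiseIsometry (fun τ => (V τ).symm)
        (continuous_symm_of_isometry hV) F),
        pointwiseIsometry_coeFn (continuous_symm_of_isometry hV) F] with τ h1 h2
      rw [h1, h2, LinearIsometryEquiv.apply_symm_apply]⟩

theorem pointwise_coeFn {V : ℝ → (E ≃ₗᵢ[ℂ] E)} (hV : ∀ x, Continuous fun t => V t x)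
    (F : WaveSpace E) : pointwise V hV F =ᵐ[volume] fun τ => V τ (F τ) :=
  pointwiseIsometry_coeFn hV F

theorem pointwise_symm_coeFn {V : ℝ → (E ≃ₗᵢ[ℂ] E)} (hV : ∀ x, Continuous fun t => V t x)
    (F : WaveSpace E) : (pointwise V hV).symm F =ᵐ[volume] fun τ => (V τ).symm (F τ) := by
  filter_upwards [pointwise_coeFn hV ((pointwise V hV).symm F)] with τ h
  rw [LinearIsometryEquiv.apply_symm_apply] at h
  rw [h, LinearIsometryEquiv.symm_apply_apply]

/-- The evolution `F ↦ (τ ↦ U F(τ - t))`. -/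
def waveEvolution (U : E ≃ₗᵢ[ℂ] E) (t : ℝ) : WaveSpace E ≃ₗᵢ[ℂ] WaveSpace E :=
  (translate t).trans (pointwise (fun _ => U) fun _ => continuous_const)

theorem waveEvolution_coeFn (U : E ≃ₗᵢ[ℂ] E) (t : ℝ) (F : WaveSpace E) :
    waveEvolution U t F =ᵐ[volume] fun τ => U (F (τ - t)) := by
  filter_upwards [pointwise_coeFn (V := fun _ => U) (fun _ => continuous_const) (translate t F),
    translate_coeFn t F] with τ h1 h2
  rw [← h2, ← h1]
  rfl

end WaveSpace

/-! ### The clock Hamiltonian generates the translations -/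

section Clock

theorem memLp_test {φ : ℝ → ℝ} (hφ : Continuous φ) (hc : HasCompactSupport φ) :
    MemLp (fun τ => (φ τ : ℂ)) 2 (volume : Measure ℝ) :=
  (Complex.continuous_ofReal.comp hφ).memLp_of_hasCompactSupport
    (hc.comp_left (g := fun r : ℝ => (r : ℂ)) Complex.ofReal_zero)

/-- The pairing `f ↦ ∫ φ f` with a test function. -/
def testPairing {φ : ℝ → ℝ} (hφ : Continuous φ) (hc : HasCompactSupport φ) : ClockSpace →L[ℂ] ℂ :=
  innerSL ℂ ((memLp_test hφ hc).toLp _)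

theorem testPairing_apply {φ : ℝ → ℝ} (hφ : Continuous φ) (hc : HasCompactSupport φ)
    (f : ClockSpace) : testPairing hφ hc f = ∫ τ, φ τ • f τ := by
  rw [testPairing, innerSL_apply_apply, L2.inner_def]
  refine integral_congr_ae ?_
  filter_upwards [(memLp_test hφ hc).coeFn_toLp] with τ h
  rw [h]
  simp [mul_comm]

theorem testPairing_translate {φ : ℝ → ℝ} (hφ : Continuous φ) (hc : HasCompactSupport φ)
    (t : ℝ) (f : ClockSpace) : testPairing hφ hc (translate t f) = ∫ τ, φ (τ + t) • f τ := by
  rw [testPairing_apply, ← integral_sub_right_eq_self (fun τ => φ (τ + t) • f τ) t]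
  refine integral_congr_ae ?_
  filter_upwards [translate_coeFn t f] with τ h
  rw [h, sub_add_cancel]

/-- As a function of `t` the pairing is the convolution of `f` with the reflected test function,
evaluated at `-t`. The derivative thus falls on `φ`, and `f` need only be in `L²`. -/
theorem hasDerivAt_testPairing_translate {φ : ℝ → ℝ} (hφ : ContDiff ℝ ∞ φ)
    (hc : HasCompactSupport φ) (f : ClockSpace) (t : ℝ) :
    HasDerivAt (fun t => testPairing hφ.continuous hc (translate t f))
      (∫ τ, deriv φ (τ + t) • f τ) t := by
  have hneg : HasCompactSupport fun τ => φ (-τ) := hc.comp_homeomorph (Homeomorph.neg ℝ)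
  have h1 := HasCompactSupport.hasDerivAt_convolution_right
    (ContinuousLinearMap.lsmul ℝ ℝ).flip (μ := (volume : Measure ℝ))
    ((Lp.memLp f).locallyIntegrable (by norm_num)) hneg
    ((hφ.of_le (by simp)).comp contDiff_neg) (-t)
  have h2 := h1.scomp t (hasDerivAt_neg t)
  have h3 : deriv (fun τ => φ (-τ)) = fun τ => -deriv φ (-τ) := by
    funext τ
    exact deriv_comp_neg φ τ
  rw [h3] at h2
  have h4 : (fun t => testPairing hφ.continuous hc (translate t f)) =
      convolution f (fun τ => φ (-τ)) (ContinuousLinearMap.lsmul ℝ ℝ).flip volume ∘ Neg.neg := by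
    funext s
    rw [testPairing_translate]
    refine integral_congr_ae (Filter.Eventually.of_forall fun τ => ?_)
    change φ (τ + s) • f τ = φ (-(-s - τ)) • f τ
    congr 2
    ring
  have h5 : ∫ τ, deriv φ (τ + t) • f τ = (-1 : ℝ) • convolution f (fun τ => -deriv φ (-τ))
      (ContinuousLinearMap.lsmul ℝ ℝ).flip volume (-t) := by
    rw [neg_one_smul, convolution_def, ← integral_neg]
    refine integral_congr_ae (Filter.Eventually.of_forall fun τ => ?_)
    change deriv φ (τ + t) • f τ = -((-deriv φ (-(-t - τ))) • f τ)
    rw [neg_smul, neg_neg]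
    congr 2
    ring
  rw [h4, h5]
  exact h2

theorem isUnitaryGroupOf_clockHamiltonian {hbar : ℝ} (hh : hbar ≠ 0) :
    IsUnitaryGroupOf hbar (clockHamiltonian hbar) translate := by
  have hT := isUnitaryGroup_translate (E := ℂ)
  refine ⟨hT.map_add, hT.continuous, fun f h => ?_⟩
  rw [clockHamiltonian, Submodule.toLinearPMap_graph_eq _ (clockGraph_snd_eq_zero hbar)]
  set c := -(Complex.I / (hbar : ℂ)) with hc
  have hh' : (hbar : ℂ) ≠ 0 := Complex.ofReal_ne_zero.mpr hh
  have hcI : c * (Complex.I * hbar) = 1 := by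
    rw [hc]; field_simp; simp
  constructor
  · intro hfh
    -- Testing against `φ` cannot show differentiability in the `L²` norm directly, but the
    -- integrated equation is an identity in `L²`, which test functions do detect.
    rw [hT.hasDerivAt_zero_iff]
    intro t
    rw [← sub_eq_zero, Lp.eq_zero_iff_ae_eq_zero]
    refine ae_eq_zero_of_integral_contDiff_smul_eq_zero
      ((Lp.memLp _).locallyIntegrable (by norm_num)) fun φ hφ hφc => ?_
    have hcomm := (testPairing hφ.continuous hφc).intervalIntegral_comp_comm
      ((hT.continuous (c • h)).intervalIntegrable (μ := volume) 0 t)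
    rw [← testPairing_apply hφ.continuous hφc, map_sub, sub_eq_zero, map_sub]
    refine Eq.trans ?_ hcomm
    have h1 : ∀ s, HasDerivAt (fun t => testPairing hφ.continuous hφc (translate t f))
        (testPairing hφ.continuous hφc (translate s (c • h))) s := by
      intro s
      have h2 := hasDerivAt_testPairing_translate hφ hφc f s
      -- The weak equation is used with the shifted test function `φ(· + s)`, which gives the
      -- derivative at time `s`.
      have h3 := hfh (fun τ => φ (τ + s)) (hφ.comp (contDiff_id.add contDiff_const))
        (hφc.comp_homeomorph (Homeomorph.addRight s))
      simp only [deriv_comp_add_const] at h3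
      rw [map_smul, map_smul, testPairing_translate, h3, smul_eq_mul, ← mul_assoc, hcI, one_mul]
      exact h2
    rw [intervalIntegral.integral_eq_sub_of_hasDerivAt (fun s _ => h1 s), hT.map_zero]
    exact ((testPairing hφ.continuous hφc).continuous.comp
      (hT.continuous (c • h))).intervalIntegrable _ _
  · intro hd φ hφ hφc
    have h1 := hasDerivAt_testPairing_translate hφ hφc f 0
    have h2 := ((testPairing hφ.continuous hφc).restrictScalars ℝ).hasFDerivAt.comp_hasDerivAt
      (0 : ℝ) hd
    have h3 := h1.unique h2
    simp only [add_zero, ContinuousLinearMap.coe_restrictScalars', map_smul,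
      testPairing_apply] at h3
    rw [h3, smul_eq_mul, ← mul_assoc, mul_comm _ c, hcI, one_mul]

end Clock

/-! ### Noninteracting sums generate product groups -/

section ProductGroups

variable {E F : Type*} [NormedAddCommGroup E] [InnerProductSpace ℂ E]
  [NormedAddCommGroup F] [InnerProductSpace ℂ F]

variable (E F) in
/-- The product vector as a continuous bilinear map. -/
def prodVecL : E →L[ℂ] F →L[ℂ] HilbertTensor E F :=
  (ContinuousLinearMap.compL ℂ F (E ⊗[ℂ] F) (HilbertTensor E F)
    UniformSpace.Completion.toComplL).comp (TensorProduct.mkL ℂ E F)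

theorem eq_top_of_prodVec_mem {K : Submodule ℂ (HilbertTensor E F)}
    (hK : IsClosed (K : Set (HilbertTensor E F))) (h : ∀ x y, prodVec x y ∈ K) : K = ⊤ := by
  rw [Submodule.eq_top_iff']
  intro Φ
  induction Φ using UniformSpace.Completion.induction_on with
  | hp => exact hK
  | ih z =>
    induction z using TensorProduct.induction_on with
    | zero => rw [UniformSpace.Completion.coe_zero]; exact K.zero_mem
    | tmul x y => exact h x y
    | add z w hz hw => rw [UniformSpace.Completion.coe_add]; exact K.add_mem hz hw

theorem continuousLinearMap_ext_prodVec {G : Type*} [NormedAddCommGroup G] [NormedSpace ℂ G]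
    {S T : HilbertTensor E F →L[ℂ] G} (h : ∀ x y, S (prodVec x y) = T (prodVec x y)) : S = T := by
  have h1 := eq_top_of_prodVec_mem (K := S.toLinearMap.eqLocus T.toLinearMap)
    (isClosed_eq S.continuous T.continuous) h
  ext Φ
  have h2 : Φ ∈ S.toLinearMap.eqLocus T.toLinearMap := h1 ▸ Submodule.mem_top
  exact h2

theorem linearIsometryEquiv_ext_prodVec {G : Type*} [NormedAddCommGroup G] [InnerProductSpace ℂ G]
    {S T : HilbertTensor E F ≃ₗᵢ[ℂ] G} (h : ∀ x y, S (prodVec x y) = T (prodVec x y))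
    (Φ : HilbertTensor E F) : S Φ = T Φ :=
  DFunLike.congr_fun (continuousLinearMap_ext_prodVec
    (S := (S.toContinuousLinearEquiv : HilbertTensor E F →L[ℂ] G))
    (T := (T.toContinuousLinearEquiv : HilbertTensor E F →L[ℂ] G)) h) Φ

/-- Product vectors suffice: the group law is an equality of bounded operators, and continuity of
orbits is a closed linear condition because each `T t` is isometric. -/
theorem isUnitaryGroup_of_prodVec {Ua : ℝ → (E ≃ₗᵢ[ℂ] E)} {Ub : ℝ → (F ≃ₗᵢ[ℂ] F)}
    (ha : IsUnitaryGroup Ua) (hb : IsUnitaryGroup Ub)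
    {T : ℝ → (HilbertTensor E F ≃ₗᵢ[ℂ] HilbertTensor E F)}
    (hT : ∀ t x y, T t (prodVec x y) = prodVec (Ua t x) (Ub t y)) : IsUnitaryGroup T where
  map_add s t Φ := linearIsometryEquiv_ext_prodVec (S := T (s + t)) (T := (T t).trans (T s))
    (fun x y => by
      rw [LinearIsometryEquiv.trans_apply, hT, hT, hT, ha.map_add, hb.map_add]) Φ
  continuous := by
    let K : Submodule ℂ (HilbertTensor E F) :=
      { carrier := {Φ | Continuous fun t => T t Φ}
        zero_mem' := by simp only [Set.mem_ofPred_eq, map_zero]; exact continuous_const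
        add_mem' := fun h1 h2 => by
          simp only [Set.mem_ofPred_eq, map_add] at *; exact h1.add h2
        smul_mem' := fun c Φ h => by
          simp only [Set.mem_ofPred_eq, map_smul] at *; exact h.const_smul c }
    have hK : K = ⊤ := by
      refine eq_top_of_prodVec_mem (isClosed_setOf_continuous_orbit T) fun x y => ?_
      change Continuous fun t => T t (prodVec x y)
      simp only [hT]
      exact ((prodVecL E F).continuous.comp (ha.continuous x)).clm_apply (hb.continuous y)
    intro Φ
    have : Φ ∈ K := hK ▸ Submodule.mem_top
    exact this

/-- `U t` commutes with `U s`, hence passes through the derivative. It supplies the invariance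
required by the core criterion. -/
theorem IsUnitaryGroupOf.apply_mem_graph {hbar : ℝ} {A : E →ₗ.[ℂ] E} {U : ℝ → (E ≃ₗᵢ[ℂ] E)}
    (h : IsUnitaryGroupOf hbar A U) (t : ℝ) {x y : E} (hxy : (x, y) ∈ A.graph) :
    (U t x, U t y) ∈ A.graph := by
  rw [h.generator] at hxy ⊢
  have h1 := ((U t).toContinuousLinearEquiv : E →L[ℂ] E).restrictScalars ℝ
    |>.hasFDerivAt.comp_hasDerivAt (0 : ℝ) hxy
  have h2 : (fun s => U s (U t x)) = fun s => U t (U s x) := by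
    funext s
    rw [← h.map_add, ← h.map_add, add_comm]
  rw [h2, ← map_smul]
  exact h1

/-- The generator of a product group is the noninteracting sum of the generators. -/
theorem isUnitaryGroupOf_noninteractingSum [CompleteSpace E] [CompleteSpace F] {hbar : ℝ}
    (hh : hbar ≠ 0) {A : E →ₗ.[ℂ] E} {B : F →ₗ.[ℂ] F} {Ua : ℝ → (E ≃ₗᵢ[ℂ] E)}
    {Ub : ℝ → (F ≃ₗᵢ[ℂ] F)} (ha : IsUnitaryGroupOf hbar A Ua) (hb : IsUnitaryGroupOf hbar B Ub)
    {T : ℝ → (HilbertTensor E F ≃ₗᵢ[ℂ] HilbertTensor E F)}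
    (hT : ∀ t x y, T t (prodVec x y) = prodVec (Ua t x) (Ub t y)) :
    IsUnitaryGroupOf hbar (noninteractingSum A B) T := by
  have hTg := isUnitaryGroup_of_prodVec ha.isUnitaryGroup hb.isUnitaryGroup hT
  set c := -(Complex.I / (hbar : ℂ))
  refine hTg.isUnitaryGroupOf_of_core hh ?_ ?_ ?_
  · intro p hp
    induction hp using Submodule.span_induction with
    | zero =>
      simp only [Prod.fst_zero, Prod.snd_zero, map_zero, smul_zero]
      exact hasDerivAt_const _ _
    | add p q _ _ hp hq =>
      simp only [Prod.fst_add, Prod.snd_add, map_add, smul_add]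
      exact hp.add hq
    | smul c p _ hp =>
      simp only [Prod.smul_fst, Prod.smul_snd, map_smul]
      rw [smul_comm]
      exact hp.const_smul c
    | mem p hp =>
      obtain ⟨x, y, rfl⟩ := hp
      have h1 := (ha.generator _ _).mp (A.mem_graph x)
      have h2 := (hb.generator _ _).mp (B.mem_graph y)
      have h3 := ContinuousLinearMap.hasDerivAt_of_bilinear
        (B := (prodVecL E F).bilinearRestrictScalars ℝ) (fun _ => h1) (fun _ => h2)
      simp only [hT]
      rw [ha.isUnitaryGroup.map_zero, hb.isUnitaryGroup.map_zero] at h3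
      have h4 : c • (prodVec (A x) (y : F) + prodVec (x : E) (B y)) =
          prodVecL E F x (c • B y) + prodVecL E F (c • A x) y := by
        rw [map_smul, map_smul, smul_apply, smul_add, add_comm]
        rfl
      rw [h4]
      exact h3
  · intro t p hp
    induction hp using Submodule.span_induction with
    | zero => simp only [Prod.fst_zero, Prod.snd_zero, map_zero]; exact Submodule.zero_mem _
    | add p q _ _ hp hq =>
      simp only [Prod.fst_add, Prod.snd_add, map_add]
      exact Submodule.add_mem _ hp hq
    | smul c p _ hp =>
      simp only [Prod.smul_fst, Prod.smul_snd, map_smul]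
      exact Submodule.smul_mem _ c hp
    | mem p hp =>
      obtain ⟨x, y, rfl⟩ := hp
      obtain ⟨x', hx, hx'⟩ := (LinearPMap.mem_graph_iff A).mp (ha.apply_mem_graph t (A.mem_graph x))
      obtain ⟨y', hy, hy'⟩ := (LinearPMap.mem_graph_iff B).mp (hb.apply_mem_graph t (B.mem_graph y))
      refine Submodule.subset_span ⟨x', y', ?_⟩
      simp only [map_add, hT]
      rw [hx, hx', hy, hy']
  · set N := Submodule.span ℂ {p : HilbertTensor E F × HilbertTensor E F |
      ∃ (x : A.domain) (y : B.domain),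
        p = (prodVec (x : E) (y : F), prodVec (A x) (y : F) + prodVec (x : E) (B y))}
    -- Density is obtained by freeing one tensor factor at a time: `y` in `h2`, then `x` in `h3`.
    have h1 : ∀ x ∈ A.domain, ∀ y ∈ B.domain,
        prodVec x y ∈ (N.map (LinearMap.fst ℂ _ _)).topologicalClosure := fun x hx y hy =>
      Submodule.le_topologicalClosure _
        ⟨_, Submodule.subset_span ⟨⟨x, hx⟩, ⟨y, hy⟩, rfl⟩, rfl⟩
    have hcl := (N.map (LinearMap.fst ℂ _ _)).isClosed_topologicalClosure
    have h2 : ∀ x ∈ A.domain, ∀ y,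
        prodVec x y ∈ (N.map (LinearMap.fst ℂ _ _)).topologicalClosure := fun x hx y =>
      (hb.dense_domain hh).induction (h1 x hx) (hcl.preimage (prodVecL E F x).continuous) y
    have h3 : ∀ x y, prodVec x y ∈ (N.map (LinearMap.fst ℂ _ _)).topologicalClosure := fun x y =>
      (ha.dense_domain hh).induction (fun x hx => h2 x hx y)
        (hcl.preimage ((prodVecL E F).flip y).continuous) x
    have h4 := Submodule.dense_iff_topologicalClosure_eq_top.mpr (eq_top_of_prodVec_mem hcl h3)
    simpa using h4

end ProductGroups

/-! ### The total space as a space of wave functions -/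

section Representation

variable {E : Type*} [NormedAddCommGroup E] [InnerProductSpace ℂ E]

/-- The wave function `f(τ) x`. -/
def smulWave (f : ClockSpace) (x : E) : WaveSpace E :=
  (ContinuousLinearMap.toSpanSingleton ℂ x).compLp f

theorem smulWave_coeFn (f : ClockSpace) (x : E) :
    smulWave f x =ᵐ[volume] fun τ => f τ • x :=
  (ContinuousLinearMap.toSpanSingleton ℂ x).coeFn_compLp f

variable (E) in
/-- The map `f ⊗ x ↦ f(·) x` on the algebraic tensor product. -/
def tensorWave : ClockSpace ⊗[ℂ] E →ₗ[ℂ] WaveSpace E :=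
  TensorProduct.lift (LinearMap.mk₂ ℂ smulWave
    (fun f g x => Lp.ext (by
      filter_upwards [smulWave_coeFn (f + g) x, smulWave_coeFn f x, smulWave_coeFn g x,
        Lp.coeFn_add f g, Lp.coeFn_add (smulWave f x) (smulWave g x)] with τ h1 h2 h3 h4 h5
      rw [h1, h5, Pi.add_apply, h2, h3, h4, Pi.add_apply, add_smul]))
    (fun c f x => Lp.ext (by
      filter_upwards [smulWave_coeFn (c • f) x, smulWave_coeFn f x, Lp.coeFn_smul c f,
        Lp.coeFn_smul c (smulWave f x)] with τ h1 h2 h3 h4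
      rw [h1, h4, Pi.smul_apply, h2, h3, Pi.smul_apply, smul_assoc]))
    (fun f x y => Lp.ext (by
      filter_upwards [smulWave_coeFn f (x + y), smulWave_coeFn f x, smulWave_coeFn f y,
        Lp.coeFn_add (smulWave f x) (smulWave f y)] with τ h1 h2 h3 h4
      rw [h1, h4, Pi.add_apply, h2, h3, smul_add]))
    (fun c f x => Lp.ext (by
      filter_upwards [smulWave_coeFn f (c • x), smulWave_coeFn f x,
        Lp.coeFn_smul c (smulWave f x)] with τ h1 h2 h3
      rw [h1, h3, Pi.smul_apply, h2, smul_comm])))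

theorem tensorWave_tmul (f : ClockSpace) (x : E) : tensorWave E (f ⊗ₜ x) = smulWave f x := rfl

theorem inner_smulWave (f g : ClockSpace) (x y : E) :
    inner ℂ (smulWave f x) (smulWave g y) = inner ℂ f g * inner ℂ x y := by
  rw [L2.inner_def, L2.inner_def, ← integral_mul_const]
  refine integral_congr_ae ?_
  filter_upwards [smulWave_coeFn f x, smulWave_coeFn g y] with τ h1 h2
  rw [h1, h2, inner_smul_left, inner_smul_right, RCLike.inner_apply]
  ring

theorem inner_tensorWave (z w : ClockSpace ⊗[ℂ] E) :
    inner ℂ (tensorWave E z) (tensorWave E w) = inner ℂ z w := by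
  induction z using TensorProduct.induction_on with
  | zero => simp
  | add z z' hz hz' => rw [map_add, inner_add_left, inner_add_left, hz, hz']
  | tmul f x =>
    induction w using TensorProduct.induction_on with
    | zero => simp
    | add w w' hw hw' => rw [map_add, inner_add_right, inner_add_right, hw, hw']
    | tmul g y => rw [tensorWave_tmul, tensorWave_tmul, inner_smulWave, TensorProduct.inner_tmul]

variable [CompleteSpace E]

variable (E) in
/-- The isometry of the total space into `L²(ℝ; E)`. -/
def waveIsometry : TotalSpace E →ₗᵢ[ℂ] WaveSpace E where
  toLinearMap := ((tensorWave E).isometryOfInner inner_tensorWave).toContinuousLinearMap.extend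
    (UniformSpace.Completion.toComplL (𝕜 := ℂ) (E := ClockSpace ⊗[ℂ] E))
  norm_map' Φ := by
    induction Φ using UniformSpace.Completion.induction_on with
    | hp => exact isClosed_eq (ContinuousLinearMap.continuous _).norm continuous_norm
    | ih z =>
      have h := ((tensorWave E).isometryOfInner inner_tensorWave).toContinuousLinearMap.extend_eq
        (e := UniformSpace.Completion.toComplL (𝕜 := ℂ) (E := ClockSpace ⊗[ℂ] E))
        UniformSpace.Completion.denseRange_coe
        (UniformSpace.Completion.isUniformInducing_coe _) z
      rw [UniformSpace.Completion.norm_coe,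
        ← ((tensorWave E).isometryOfInner inner_tensorWave).norm_map z]
      exact congrArg norm h

theorem waveIsometry_prodVec (f : ClockSpace) (x : E) :
    waveIsometry E (prodVec f x) = smulWave f x :=
  ((tensorWave E).isometryOfInner inner_tensorWave).toContinuousLinearMap.extend_eq
    (e := UniformSpace.Completion.toComplL (𝕜 := ℂ) (E := ClockSpace ⊗[ℂ] E))
    UniformSpace.Completion.denseRange_coe
    (UniformSpace.Completion.isUniformInducing_coe _) (f ⊗ₜ x)

/-- The range of an isometry on a complete space is closed, and it contains the step functions `1_s
c`, images of `1_s ⊗ c`. -/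
theorem waveIsometry_surjective : Function.Surjective (waveIsometry E) := by
  have hcl : IsClosed (Set.range (waveIsometry E)) :=
    (waveIsometry E).isometry.isClosedEmbedding.isClosed_range
  intro F
  refine Lp.induction (by norm_num) (fun F => F ∈ Set.range (waveIsometry E)) ?_ ?_ hcl F
  · intro c s hs hμs
    refine ⟨prodVec (indicatorConstLp 2 hs hμs.ne 1) c, ?_⟩
    rw [waveIsometry_prodVec, Lp.simpleFunc.coe_indicatorConst]
    refine Lp.ext ?_
    filter_upwards [smulWave_coeFn (indicatorConstLp 2 hs hμs.ne 1) c,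
      indicatorConstLp_coeFn (p := 2) (hs := hs) (hμs := hμs.ne) (c := c),
      indicatorConstLp_coeFn (p := 2) (hs := hs) (hμs := hμs.ne) (c := (1 : ℂ))] with τ h1 h2 h3
    rw [h1, h2, h3]
    by_cases hτ : τ ∈ s <;> simp [hτ]
  · rintro f g hf hg - ⟨Φ, hΦ⟩ ⟨Ψ, hΨ⟩
    exact ⟨Φ + Ψ, by rw [map_add, hΦ, hΨ]⟩

variable (E) in
/-- The identification of `L²(ℝ) ⊗ E` with `L²(ℝ; E)`. -/
def waveIso : TotalSpace E ≃ₗᵢ[ℂ] WaveSpace E :=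
  LinearIsometryEquiv.ofSurjective (waveIsometry E) waveIsometry_surjective

theorem waveIso_prodVec (f : ClockSpace) (x : E) : waveIso E (prodVec f x) = smulWave f x :=
  waveIsometry_prodVec f x

theorem inner_prodVec (f : ClockSpace) (x : E) (Φ : TotalSpace E) :
    inner ℂ (prodVec f x) Φ = ∫ τ, inner ℂ (f τ • x) (waveIso E Φ τ) := by
  rw [← (waveIso E).inner_map_map, waveIso_prodVec, L2.inner_def]
  refine integral_congr_ae ?_
  filter_upwards [smulWave_coeFn f x] with τ h
  rw [h]

theorem hasWaveFunction_of_ae_eq {Φ : TotalSpace E} {F : ℝ → E}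
    (h : waveIso E Φ =ᵐ[volume] F) : HasWaveFunction Φ F := by
  intro f x
  rw [inner_prodVec]
  refine integral_congr_ae ?_
  filter_upwards [h] with τ h
  rw [h]

/-- Pairings with product vectors determine a vector, so `Φ` must be the preimage of the `L²` class
of `F`. -/
theorem HasWaveFunction.ae_eq {Φ : TotalSpace E} {F : ℝ → E} (h : HasWaveFunction Φ F)
    (hF : Continuous F) (hFc : HasCompactSupport F) : waveIso E Φ =ᵐ[volume] F := by
  have hm : MemLp F 2 (volume : Measure ℝ) := hF.memLp_of_hasCompactSupport hFc
  set Ψ := (waveIso E).symm (hm.toLp F) with hΨ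
  have h1 : waveIso E Ψ =ᵐ[volume] F := by
    rw [hΨ, LinearIsometryEquiv.apply_symm_apply]
    exact hm.coeFn_toLp
  have h2 : innerSL ℂ Φ = innerSL ℂ Ψ := continuousLinearMap_ext_prodVec fun f x => by
    rw [innerSL_apply_apply, innerSL_apply_apply, ← inner_conj_symm, h f x,
      ← hasWaveFunction_of_ae_eq h1 f x, inner_conj_symm]
  have h3 : Φ = Ψ := ext_inner_right ℂ fun v => DFunLike.congr_fun h2 v
  rwa [h3]

end Representation

/-! ### Unitary equivalence of Page-Wootters systems -/

section Equivalence

variable {E : Type*} [NormedAddCommGroup E] [InnerProductSpace ℂ E]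

/-- Multiplication by a phase. -/
def phaseIsometry (c : ℂ) (hc : ‖c‖ = 1) : E ≃ₗᵢ[ℂ] E where
  toLinearEquiv := LinearEquiv.smulOfNeZero ℂ E c
    (norm_ne_zero_iff.mp (by rw [hc]; exact one_ne_zero))
  norm_map' x := by
    change ‖c • x‖ = ‖x‖
    rw [norm_smul, hc, one_mul]

theorem exists_phase (z : ℂ) : ∃ c : ℂ, ‖c‖ = 1 ∧ (c * z).im = 0 := by
  rcases eq_or_ne z 0 with rfl | hz
  · exact ⟨1, by simp⟩
  · have hz' : ‖z‖ ≠ 0 := norm_ne_zero_iff.mpr hz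
    refine ⟨conj z / ‖z‖, ?_, ?_⟩
    · rw [norm_div, RCLike.norm_conj, Complex.norm_real, norm_norm, div_self hz']
    · rw [div_mul_eq_mul_div, Complex.conj_mul', ← Complex.ofReal_pow, ← Complex.ofReal_div]
      exact Complex.ofReal_im _

/-- The unitary group acts transitively on the unit sphere. -/
theorem exists_linearIsometryEquiv_apply_eq {x y : E} (hx : ‖x‖ = 1) (hy : ‖y‖ = 1) :
    ∃ W : E ≃ₗᵢ[ℂ] E, W x = y := by
  -- A reflection can exchange two unit vectors only if their inner product is real; the phase
  -- arranges this.
  obtain ⟨c, hc, him⟩ := exists_phase (inner ℂ y x)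
  set v := c • x with hv
  have hvn : ‖v‖ = 1 := by rw [hv, norm_smul, hc, hx, one_mul]
  have hre : (((inner ℂ y v).re : ℝ) : ℂ) = inner ℂ y v := by
    apply Complex.ext
    · simp
    · rw [Complex.ofReal_im, hv, inner_smul_right, him]
  refine ⟨(phaseIsometry c hc).trans ((ℂ ∙ (v - y))ᗮ.reflection), ?_⟩
  change (ℂ ∙ (v - y))ᗮ.reflection v = y
  rw [Submodule.reflection_orthogonal_apply, Submodule.reflection_apply,
    Submodule.starProjection_singleton]
  rcases eq_or_ne v y with h | h
  · simp [h]
  have hpos : ‖v - y‖ ^ 2 ≠ 0 := pow_ne_zero _ (norm_ne_zero_iff.mpr (sub_ne_zero.mpr h))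
  -- For unit vectors with real inner product, `‖v - y‖² = 2 ⟪v - y, v⟫`: the projection of `v` on
  -- `v - y` is half of `v - y`, so the reflection sends `v` to `y`.
  have h1 : ((‖v - y‖ ^ 2 : ℝ) : ℂ) = 2 * inner ℂ (v - y) v := by
    have h2 : ‖v - y‖ ^ 2 = 2 * (1 - (inner ℂ y v).re) := by
      rw [norm_sub_sq (𝕜 := ℂ), hvn, hy, ← inner_re_symm]
      simp only [RCLike.re_to_complex]
      ring
    rw [h2, inner_sub_left, inner_self_eq_norm_sq_to_K, hvn, ← hre]
    push_cast
    norm_num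
  have h3 : (2 * inner ℂ (v - y) v / ((‖v - y‖ ^ 2 : ℝ) : ℂ)) = 1 := by
    rw [← h1]
    exact div_self (Complex.ofReal_ne_zero.mpr hpos)
  have h4 : (2 : ℕ) • (inner ℂ (v - y) v / ((‖v - y‖ ^ 2 : ℝ) : ℂ)) • (v - y) = v - y := by
    rw [← Nat.cast_smul_eq_nsmul ℂ, smul_smul, Nat.cast_ofNat, ← mul_div_assoc, h3, one_smul]
  have h5 : ∀ w : E, w = v - y → -(w - v) = y := by
    rintro _ rfl
    abel
  exact h5 _ h4

/-- The unitary operators `U'(τ) W U(-τ)` that carry one history to another. -/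
def historyTransport (U U' : ℝ → (E ≃ₗᵢ[ℂ] E)) (W : E ≃ₗᵢ[ℂ] E) (τ : ℝ) : E ≃ₗᵢ[ℂ] E :=
  ((U (-τ)).trans W).trans (U' τ)

theorem continuous_historyTransport {U U' : ℝ → (E ≃ₗᵢ[ℂ] E)} (hU : IsUnitaryGroup U)
    (hU' : IsUnitaryGroup U') (W : E ≃ₗᵢ[ℂ] E) (x : E) :
    Continuous fun τ => historyTransport U U' W τ x :=
  (continuous_uncurry_of_isometry hU'.continuous).comp
    (continuous_id.prodMk (W.continuous.comp ((hU.continuous x).comp continuous_neg)))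

/-- Evolving by `t` before the transport only shortens the backward evolution from `τ` to `τ - t`,
and the group law of `U'` restores the missing `t`. -/
theorem historyTransport_apply_evolution {U U' : ℝ → (E ≃ₗᵢ[ℂ] E)} (hU : IsUnitaryGroup U)
    (hU' : IsUnitaryGroup U') (W : E ≃ₗᵢ[ℂ] E) (t τ : ℝ) (x : E) :
    historyTransport U U' W τ (U t x) = U' t (historyTransport U U' W (τ - t) x) := by
  change U' τ (W (U (-τ) (U t x))) = U' t (U' (τ - t) (W (U (-(τ - t)) x)))
  rw [← hU.map_add, ← hU'.map_add, add_sub_cancel, neg_sub, neg_add_eq_sub]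

/-! ### Fibrewise unitaries on the total space and their action on generalized vectors -/

variable [CompleteSpace E]

/-- The unitary operator on the total space that acts on wave functions as
`F ↦ (τ ↦ V(τ) F(τ))`. -/
def totalPointwise (V : ℝ → (E ≃ₗᵢ[ℂ] E)) (hV : ∀ x, Continuous fun t => V t x) :
    TotalSpace E ≃ₗᵢ[ℂ] TotalSpace E :=
  ((waveIso E).trans (pointwise V hV)).trans (waveIso E).symm

/-- The evolution of the total space by the clock and the rest of the world. -/
def totalEvolution (U : ℝ → (E ≃ₗᵢ[ℂ] E)) (t : ℝ) : TotalSpace E ≃ₗᵢ[ℂ] TotalSpace E :=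
  ((waveIso E).trans (waveEvolution (U t) t)).trans (waveIso E).symm

theorem totalEvolution_prodVec (U : ℝ → (E ≃ₗᵢ[ℂ] E)) (t : ℝ) (f : ClockSpace) (x : E) :
    totalEvolution U t (prodVec f x) = prodVec (translate t f) (U t x) := by
  change (waveIso E).symm (waveEvolution (U t) t (waveIso E (prodVec f x))) = _
  rw [LinearIsometryEquiv.symm_apply_eq, waveIso_prodVec, waveIso_prodVec]
  refine Lp.ext ?_
  filter_upwards [waveEvolution_coeFn (U t) t (smulWave f x), ae_comp_sub (smulWave_coeFn f x) t,
    smulWave_coeFn (translate t f) (U t x), translate_coeFn t f] with τ h1 h2 h3 h4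
  rw [h1, h2, h3, h4, map_smul]

theorem isUnitaryGroupOf_totalHamiltonian {hbar : ℝ} (hh : hbar ≠ 0) {Hr : E →ₗ.[ℂ] E}
    {U : ℝ → (E ≃ₗᵢ[ℂ] E)} (hU : IsUnitaryGroupOf hbar Hr U) :
    IsUnitaryGroupOf hbar (totalHamiltonian hbar Hr) (totalEvolution U) :=
  isUnitaryGroupOf_noninteractingSum hh (isUnitaryGroupOf_clockHamiltonian hh) hU
    (totalEvolution_prodVec U)

/-- The shift `τ - t` in the hypothesis is exactly the clock translation inside `totalEvolution`. -/
theorem totalPointwise_totalEvolution {U U' : ℝ → (E ≃ₗᵢ[ℂ] E)} {V : ℝ → (E ≃ₗᵢ[ℂ] E)}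
    (hV : ∀ x, Continuous fun t => V t x)
    (h : ∀ t τ x, V τ (U t x) = U' t (V (τ - t) x)) (t : ℝ) (Φ : TotalSpace E) :
    totalPointwise V hV (totalEvolution U t Φ) = totalEvolution U' t (totalPointwise V hV Φ) := by
  simp only [totalPointwise, totalEvolution, LinearIsometryEquiv.trans_apply,
    LinearIsometryEquiv.apply_symm_apply]
  congr 1
  refine Lp.ext ?_
  filter_upwards [pointwise_coeFn hV (waveEvolution (U t) t (waveIso E Φ)),
    waveEvolution_coeFn (U t) t (waveIso E Φ),
    waveEvolution_coeFn (U' t) t (pointwise V hV (waveIso E Φ)),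
    ae_comp_sub (pointwise_coeFn hV (waveIso E Φ)) t] with τ h1 h2 h3 h4
  rw [h1, h2, h3, h4, h]

theorem HasWaveFunction.totalPointwise {V : ℝ → (E ≃ₗᵢ[ℂ] E)}
    (hV : ∀ x, Continuous fun t => V t x) {Φ : TotalSpace E} {F : ℝ → E}
    (h : HasWaveFunction Φ F) (hF : Continuous F) (hFc : HasCompactSupport F) :
    HasWaveFunction (totalPointwise V hV Φ) fun τ => V τ (F τ) := by
  refine hasWaveFunction_of_ae_eq ?_
  simp only [PageWootters.totalPointwise, LinearIsometryEquiv.trans_apply,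
    LinearIsometryEquiv.apply_symm_apply]
  filter_upwards [pointwise_coeFn hV (waveIso E Φ), h.ae_eq hF hFc] with τ h1 h2
  rw [h1, h2]

theorem HasWaveFunction.totalPointwise_symm {V : ℝ → (E ≃ₗᵢ[ℂ] E)}
    (hV : ∀ x, Continuous fun t => V t x) {Φ : TotalSpace E} {F : ℝ → E}
    (h : HasWaveFunction Φ F) (hF : Continuous F) (hFc : HasCompactSupport F) :
    HasWaveFunction ((PageWootters.totalPointwise V hV).symm Φ) fun τ => (V τ).symm (F τ) := by
  refine hasWaveFunction_of_ae_eq ?_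
  change waveIso E ((waveIso E).symm ((pointwise V hV).symm (waveIso E Φ))) =ᵐ[volume] _
  rw [LinearIsometryEquiv.apply_symm_apply]
  filter_upwards [pointwise_symm_coeFn hV (waveIso E Φ), h.ae_eq hF hFc] with τ h1 h2
  rw [h1, h2]

omit [CompleteSpace E] in
theorem continuous_isometry_apply {V : ℝ → (E ≃ₗᵢ[ℂ] E)} (hV : ∀ x, Continuous fun t => V t x)
    {F : ℝ → E} (hF : Continuous F) : Continuous fun τ => V τ (F τ) :=
  (continuous_uncurry_of_isometry hV).comp (continuous_id.prodMk hF)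

omit [CompleteSpace E] in
theorem hasCompactSupport_isometry_apply (V : ℝ → (E ≃ₗᵢ[ℂ] E)) {F : ℝ → E}
    (hF : HasCompactSupport F) : HasCompactSupport fun τ => V τ (F τ) :=
  hF.mono fun τ h h0 => h (by simp only [h0, map_zero])

theorem totalPointwise_mem_testSpace {V : ℝ → (E ≃ₗᵢ[ℂ] E)}
    (hV : ∀ x, Continuous fun t => V t x) {Φ : TotalSpace E} (h : Φ ∈ testSpace E) :
    totalPointwise V hV Φ ∈ testSpace E := by
  obtain ⟨F, hF, hFc, hΦ⟩ := h
  exact ⟨_, continuous_isometry_apply hV hF, hasCompactSupport_isometry_apply V hFc,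
    hΦ.totalPointwise hV hF hFc⟩

theorem totalPointwise_symm_mem_testSpace {V : ℝ → (E ≃ₗᵢ[ℂ] E)}
    (hV : ∀ x, Continuous fun t => V t x) {Φ : TotalSpace E} (h : Φ ∈ testSpace E) :
    (totalPointwise V hV).symm Φ ∈ testSpace E := by
  obtain ⟨F, hF, hFc, hΦ⟩ := h
  exact ⟨_, continuous_isometry_apply (continuous_symm_of_isometry hV) hF,
    hasCompactSupport_isometry_apply (fun τ => (V τ).symm) hFc, hΦ.totalPointwise_symm hV hF hFc⟩

theorem waveFunction_totalPointwise_symm {V : ℝ → (E ≃ₗᵢ[ℂ] E)}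
    (hV : ∀ x, Continuous fun t => V t x) (Φ : testSpace E)
    (h : (totalPointwise V hV).symm Φ ∈ testSpace E) (τ : ℝ) :
    waveFunction ⟨_, h⟩ τ = (V τ).symm (waveFunction Φ τ) :=
  congrFun ((hasWaveFunction_waveFunction ⟨_, h⟩).unique
    ((hasWaveFunction_waveFunction Φ).totalPointwise_symm hV (waveFunction_continuous Φ)
      (waveFunction_hasCompactSupport Φ))
    (waveFunction_continuous _) (waveFunction_hasCompactSupport _)
    (continuous_isometry_apply (continuous_symm_of_isometry hV) (waveFunction_continuous Φ))
    (hasCompactSupport_isometry_apply (fun τ => (V τ).symm)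
      (waveFunction_hasCompactSupport Φ))) τ

/-- Duality moves `(V τ).symm` from the wave function, where it acts pointwise, to `V τ` on `x`. -/
theorem mapGeneralized_ketProd {V : ℝ → (E ≃ₗᵢ[ℂ] E)} (hV : ∀ x, Continuous fun t => V t x)
    (hS : ∀ Φ ∈ testSpace E, (totalPointwise V hV).symm Φ ∈ testSpace E) (τ : ℝ) (x : E) :
    mapGeneralized (totalPointwise V hV) hS (ketProd τ x) = ketProd τ (V τ x) := by
  ext Φ
  change inner ℂ (waveFunction ⟨_, hS Φ Φ.2⟩ τ) x = inner ℂ (waveFunction Φ τ) (V τ x)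
  rw [waveFunction_totalPointwise_symm hV, ← (V τ).inner_map_map,
    LinearIsometryEquiv.apply_symm_apply]

theorem mapGeneralized_timelessState {V : ℝ → (E ≃ₗᵢ[ℂ] E)}
    (hV : ∀ x, Continuous fun t => V t x)
    (hS : ∀ Φ ∈ testSpace E, (totalPointwise V hV).symm Φ ∈ testSpace E) {ψ ψ' : C(ℝ, E)}
    (h : ∀ τ, V τ (ψ τ) = ψ' τ) :
    mapGeneralized (totalPointwise V hV) hS (timelessState ψ) = timelessState ψ' := by
  ext Φ
  refine integral_congr_ae (Filter.Eventually.of_forall fun τ => ?_)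
  have h1 := LinearMap.congr_fun (mapGeneralized_ketProd hV hS τ (ψ τ)) Φ
  rw [h] at h1
  exact h1

end Equivalence

end

end PageWootters

/-- Two bare Page-Wootters systems with the same ideal clock and the same Hilbert space of the rest
of the world, but with arbitrary world Hamiltonians `Hr`, `Hr'` and arbitrary unit initial world
states, are unitarily equivalent: one unitary operator `S` carries the total Hamiltonian, every
relative temporal state and the timeless state of the first to those of the second. -/
theorem mainTheorem6 {E : Type*} [NormedAddCommGroup E] [InnerProductSpace ℂ E] [CompleteSpace E]
    [TopologicalSpace.SeparableSpace E] (hbar : ℝ) (hhbar : 0 < hbar)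
    (Hr Hr' : E →ₗ.[ℂ] E) (hHr : IsSelfAdjoint Hr) (hHr' : IsSelfAdjoint Hr')
    (ψ₀ ψ₀' : E) (hψ₀ : ‖ψ₀‖ = 1) (hψ₀' : ‖ψ₀'‖ = 1) :
    ∃ S : PageWootters.TotalSpace E ≃ₗᵢ[ℂ] PageWootters.TotalSpace E,
      PageWootters.totalHamiltonian hbar Hr' =
        PageWootters.unitaryConj S (PageWootters.totalHamiltonian hbar Hr) ∧
      (∀ Φ ∈ PageWootters.testSpace E, S Φ ∈ PageWootters.testSpace E) ∧
      ∃ hS : ∀ Φ ∈ PageWootters.testSpace E, S.symm Φ ∈ PageWootters.testSpace E,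
        (∀ τ : ℝ, PageWootters.temporalState hbar Hr' ψ₀' τ =
          PageWootters.mapGeneralized S hS (PageWootters.temporalState hbar Hr ψ₀ τ)) ∧
        PageWootters.timelessState (PageWootters.history hbar Hr' ψ₀') =
          PageWootters.mapGeneralized S hS
            (PageWootters.timelessState (PageWootters.history hbar Hr ψ₀)) := by
  have hh : hbar ≠ 0 := hhbar.ne'
  have hU := PageWootters.isUnitaryGroupOf_evolution hh hHr
  have hU' := PageWootters.isUnitaryGroupOf_evolution hh hHr'
  obtain ⟨W, hW⟩ := PageWootters.exists_linearIsometryEquiv_apply_eq hψ₀ hψ₀'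
  have hV := PageWootters.continuous_historyTransport hU.isUnitaryGroup hU'.isUnitaryGroup W
  have hhist : ∀ τ, PageWootters.historyTransport (PageWootters.evolution hbar Hr)
      (PageWootters.evolution hbar Hr') W τ (PageWootters.history hbar Hr ψ₀ τ) =
        PageWootters.history hbar Hr' ψ₀' τ := by
    intro τ
    -- With `t = τ` the transport remaining on the right is the one at time `0`, which is `W`.
    have h := PageWootters.historyTransport_apply_evolution hU.isUnitaryGroup hU'.isUnitaryGroup
      W τ τ ψ₀
    rw [sub_self] at h
    refine h.trans ?_
    change PageWootters.evolution hbar Hr' τ (PageWootters.evolution hbar Hr' 0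
      (W (PageWootters.evolution hbar Hr (-0) ψ₀))) = PageWootters.evolution hbar Hr' τ ψ₀'
    rw [neg_zero, hU.isUnitaryGroup.map_zero, hU'.isUnitaryGroup.map_zero, hW]
  have hS : ∀ Φ ∈ PageWootters.testSpace E,
      (PageWootters.totalPointwise _ hV).symm Φ ∈ PageWootters.testSpace E :=
    fun _ => PageWootters.totalPointwise_symm_mem_testSpace hV
  refine ⟨PageWootters.totalPointwise _ hV, ?_,
    fun _ => PageWootters.totalPointwise_mem_testSpace hV, hS, fun τ => ?_, ?_⟩
  -- No domain is computed: both total Hamiltonians are full generators, so intertwining the groups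
  -- gives equality of the operators.
  · exact (PageWootters.isUnitaryGroupOf_totalHamiltonian hh hU).eq_unitaryConj
      (PageWootters.isUnitaryGroupOf_totalHamiltonian hh hU') _
      (PageWootters.totalPointwise_totalEvolution hV
        (PageWootters.historyTransport_apply_evolution hU.isUnitaryGroup hU'.isUnitaryGroup W))
  · rw [PageWootters.temporalState, PageWootters.temporalState,
      PageWootters.mapGeneralized_ketProd, hhist]
  · exact (PageWootters.mapGeneralized_timelessState hV hS hhist).symm
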